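/- **Theorem 5.4 (Sparsity of projected network data).** Let $0<\alpha<1$ and $\theta>-\alpha$, and let $X_1,X_2,\dots$ be the binary Hollywood process with parameter $(\alpha,\theta)$: each interaction $X_n=(X_{n,1},X_{n,2})$ is an ordered pair of actors, actors being labelled $1,2,\dots$ in order of appearance. The roles $X_{1,1},X_{1,2},X_{2,1},X_{2,2},\dots$ are filled one after the other: $X_{1,1}=1$, and if $m\ge 1$ roles have been filled so far, by $V$ distinct actors of whom actor $i$ has played $D(i)$ roles, then the next role goes, conditionally on the past, to actor $i\in\{1,\dots,V\}$ with probability $\frac{D(i)-\alpha}{m+\theta}$ and to the new actor $V+1$ with probability $\frac{\theta+\alpha V}{m+\theta}$. For a real cutoff $c\ge 0$ and $n\ge 1$, let $H_n^{c}$ be the projection of the first $n$ interactions with the cardinality map as thresholding function: the network without multiple edges in which an ordered pair $A$ is an edge (a self-loop if its two entries coincide) if and only if $\#\{i\le n: X_i=A\}>c$. Let $e(H)$ be the number of edges of $H$, let $v(H)$ be the number of its non-isolated vertices, i.e. those lying on at least one edge of $H$, and let $m_\bullet(H)$ be the average arity of the edges of $H$ (equal to $2$ here whenever $H$ has an edge).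 A sequence $(H_n)$ is called sparse if $e(H_n)\to\infty$ and $\limsup_{n\to\infty} e(H_n)/v(H_n)^{m_\bullet(H_n)}=0$. Then for every $c\ge 0$ the sequence $(H_n^{c})_{n\ge1}$ is sparse almost surely; in particular this holds for all $0<\alpha<1$, not only for $\alpha>1/2$. The same is true of the undirected projections, obtained by replacing each pair $X_i$ with the corresponding unordered pair (multiset of size two) before counting multiplicities. -/

import Mathlib

open MeasureTheory Filter
open scoped ENNReal

namespace Hollywood

/-- Conditional probability that the next role is given to the actor labelled `i`, when `past` is
the list of all the actors cast so far, in order (through all earlier interactions and the earlier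
roles of the current one). Actors carry the labels `1, 2, …` in order of appearance, `V` is the
number of distinct actors in `past`, and `past.count i` is the number of roles played by `i`.
The weights are `count i - α` for an actor already seen and `θ + α V` for the unseen actor `V + 1`;
they add up to `past.length + θ`. The very first role goes to actor `1` with probability one, since
there is no other choice (this also covers `θ ≤ 0`, where dividing by `θ` is not meaningful). -/
noncomputable def rolePr (α θ : ℝ) (past : List ℕ) (i : ℕ) : ℝ :=
  if past = [] then (if i = 1 then 1 else 0)
  else if i ∈ past then ((past.count i : ℝ) - α) / ((past.length : ℝ) + θ)
  else if i = past.toFinset.card + 1 then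
    (θ + α * (past.toFinset.card : ℝ)) / ((past.length : ℝ) + θ)
  else 0

/-- Conditional probability that the next `x.length` roles are given, in order, to the actors
listed in `x`, when `past` lists the actors cast before. -/
noncomputable def castPr (α θ : ℝ) : List ℕ → List ℕ → ℝ
  | _, [] => 1
  | past, i :: x => rolePr α θ past i * castPr α θ (past ++ [i]) x

/-- `X 0, X 1, X 2, …` are the interactions (finite ordered multisets of actors, as lists) of a
Hollywood process with parameter `(α, θ, ν)`, where `ν` is the arity distribution on the positive
integers: given the first `n` interactions, the number of roles of the next one is drawn from `ν`
independently of the past, and then its roles are filled one after the other with the probabilities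
`rolePr`. -/
structure IsHollywoodProcess {Ω : Type*} [MeasurableSpace Ω] (μ : Measure Ω)
    (α θ : ℝ) (ν : PMF ℕ) (X : ℕ → Ω → List ℕ) : Prop where
  arity_pos : ν 0 = 0
  measurableSet_eq : ∀ (n : ℕ) (x : List ℕ), MeasurableSet {ω | X n ω = x}
  step : ∀ (n : ℕ) (h : Fin n → List ℕ) (x : List ℕ),
    μ {ω | (∀ i : Fin n, X i ω = h i) ∧ X n ω = x} =
      μ {ω | ∀ i : Fin n, X i ω = h i} *
        (ν x.length * ENNReal.ofReal (castPr α θ (List.ofFn h).flatten x))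

/-- The binary Hollywood process: every interaction has arity two. -/
def IsBinaryHollywoodProcess {Ω : Type*} [MeasurableSpace Ω] (μ : Measure Ω)
    (α θ : ℝ) (X : ℕ → Ω → List ℕ) : Prop :=
  ∃ ν : PMF ℕ, ν 2 = 1 ∧ IsHollywoodProcess μ α θ ν X

/-- The undirected version of an interaction: its elements listed in the canonical (increasing)
order, so that the orientation is forgotten and multiplicities are kept. -/
def unorient (x : List ℕ) : List ℕ := x.insertionSort (· ≤ ·)

/-- The `(t, c)`-projection of the interaction process `I : S → fin(ℕ)`: the `{0, 1}`-valued
function on `fin(ℕ)`, written as the set of those `A` where its value is `1`, that is, those whose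
set of occurrences `{i | I i = A}` has a `t`-value exceeding the cutoff `c`. -/
def projection {S : Type*} (t : Set S → ℝ) (c : ℝ) (I : S → List ℕ) : Set (List ℕ) :=
  {A | c < t {i | I i = A}}

/-- The number `e(H)` of edges. -/
noncomputable def edgeCount (H : Set (List ℕ)) : ℕ := H.ncard

/-- The number `v(H)` of non-isolated vertices: those involved in at least one edge. -/
noncomputable def vertexCount (H : Set (List ℕ)) : ℕ := {u : ℕ | ∃ A ∈ H, u ∈ A}.ncard

/-- The number `M_k(H)` of `k`-ary edges. -/
noncomputable def arityCount (H : Set (List ℕ)) (k : ℕ) : ℕ := {A ∈ H | A.length = k}.ncard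

/-- The average arity of the edges, `e(H)⁻¹ ∑ k, k M_k(H)`. -/
noncomputable def meanArity (H : Set (List ℕ)) : ℝ :=
  (edgeCount H : ℝ)⁻¹ * ∑ᶠ k : ℕ, (k : ℝ) * (arityCount H k : ℝ)

/-- A sequence of (finite) networks is sparse if the number of edges tends to infinity and
`limsup e(H_n) / v(H_n) ^ m(H_n) = 0`, with `m` the average arity. The limsup is taken in `[0, ∞]`,
so no boundedness is presupposed. -/
def IsSparse (H : ℕ → Set (List ℕ)) : Prop :=
  Tendsto (fun n => edgeCount (H n)) atTop atTop ∧
  limsup (fun n => (edgeCount (H n) : ℝ≥0∞) / (vertexCount (H n) : ℝ≥0∞) ^ meanArity (H n))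
    atTop = 0

end Hollywood

namespace Hollywood

/-! Write `e` and `v` for the edge and vertex counts of the projection of the first `n`
interactions. Almost surely `v ≥ n ^ β` eventually for each `β < α`, at every cutoff, while `e` is
at most the number of distinct interactions, which is `O(n ^ ρ)` for each `ρ > 2α/(1+α)`. Since
`2α/(1+α) < 2α` for every `α > 0`, one can take `ρ < 2β`, and then `e / v ^ 2` tends to zero. No
restriction to `α > 1/2` arises because repeated pairs are not counted separately.

Lower bound: it suffices to look at edges `[1, i]`. The number of actors grows at least like `n ^ β`
for `β < α` (`ae_rpow_le_card`), and the degree of actor `1` grows like `n ^ β` for every `β < 1`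
(`ae_rpow_le_count_one`). Hence a given old actor is the partner of actor `1` at time `k` with
probability at least `k ^ (-1 - ε)`. This lets the property of having been such a partner `j` times
pass to `j + 1` times without loss in the exponent (`ae_rpow_le_card_partners`). Pathwise bounds
come from an exponential supermartingale comparing event counts with their accumulated conditional
probabilities (`ae_exists_sum_condExp_sub_le`).

Upper bound: let `S` be the set of actors seen by time `s`. A distinct pair lies in `S × S` or uses
a role outside `S`, so there are at most `|S| ^ 2` plus the number of outside roles
(`card_toFinset_le`). In expectation `|S|` is of order at most `s ^ α` and the outside roles of
order at most `s ^ (α - 1) * n`. Both contributions balance at `s = n ^ (1/(1+α))`, giving `n ^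
(2α/(1+α))`; Markov and Borel–Cantelli along powers of two make this pathwise
(`ae_card_toFinset_hist_le`). -/

/-! ### Role probabilities and the conditional law of the next pair -/

/-- The labels that can be cast after `h`: those in `h` and the next unused one. -/
def cands (h : List ℕ) : Finset ℕ := insert (h.toFinset.card + 1) h.toFinset

/-- The labels occurring in `h` form an initial segment of the positive integers. -/
def IsCast (h : List ℕ) : Prop := h.toFinset = Finset.Icc 1 h.toFinset.card

/-- Conditional probability, given `h`, that the next two roles satisfy `P`. -/
noncomputable def pairPr (α θ : ℝ) (h : List ℕ) (P : Set (List ℕ)) : ℝ :=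
  open Classical in
  ∑ i ∈ cands h, ∑ j ∈ cands (h ++ [i]),
    if [i, j] ∈ P then rolePr α θ h i * rolePr α θ (h ++ [i]) j else 0

theorem IsCast.new_notMem {h : List ℕ} (hh : IsCast h) : h.toFinset.card + 1 ∉ h := by
  intro hm
  rw [← List.mem_toFinset, hh, Finset.mem_Icc] at hm
  simp at hm

theorem isCast_nil : IsCast [] := by simp [IsCast]

theorem toFinset_append_singleton (h : List ℕ) (i : ℕ) :
    (h ++ [i]).toFinset = insert i h.toFinset := by
  ext; simp

theorem IsCast.append {h : List ℕ} (hh : IsCast h) {i : ℕ} (hi : i ∈ cands h) :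
    IsCast (h ++ [i]) := by
  unfold IsCast
  rw [toFinset_append_singleton]
  by_cases him : i ∈ h
  · rw [Finset.insert_eq_of_mem (by simpa using him)]; exact hh
  · have hi' : i = h.toFinset.card + 1 := by
      simpa [cands, him] using hi
    rw [Finset.card_insert_of_notMem (by simpa using him), hi']
    conv_lhs => rw [hh]
    simp only [Nat.card_Icc, add_tsub_cancel_right]
    ext x; simp; omega

theorem mem_cands_of_rolePr_ne_zero {α θ : ℝ} {h : List ℕ} {i : ℕ} (hi : rolePr α θ h i ≠ 0) :
    i ∈ cands h := by
  unfold rolePr at hi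
  simp only [cands, Finset.mem_insert, List.mem_toFinset]
  split_ifs at hi <;> simp_all

theorem one_le_card {h : List ℕ} (hne : h ≠ []) : (1 : ℝ) ≤ h.toFinset.card := by
  have : 0 < h.toFinset.card := by
    rw [Finset.card_pos]; simpa [Finset.nonempty_iff_ne_empty] using hne
  exact_mod_cast this

theorem one_le_length {h : List ℕ} (hne : h ≠ []) : (1 : ℝ) ≤ h.length := by
  exact_mod_cast List.length_pos_iff.2 hne

theorem one_le_count {h : List ℕ} {i : ℕ} (hi : i ∈ h) : (1 : ℝ) ≤ h.count i := by
  exact_mod_cast List.count_pos_iff.2 hi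

theorem rolePr_of_mem {α θ : ℝ} {h : List ℕ} {i : ℕ} (hi : i ∈ h) :
    rolePr α θ h i = (h.count i - α) / (h.length + θ) := by
  have : h ≠ [] := by rintro rfl; simp at hi
  simp [rolePr, this, hi]

theorem rolePr_new {α θ : ℝ} {h : List ℕ} (hne : h ≠ []) (hh : IsCast h) :
    rolePr α θ h (h.toFinset.card + 1) = (θ + α * h.toFinset.card) / (h.length + θ) := by
  have := hh.new_notMem
  unfold rolePr
  rw [if_neg hne, if_neg this, if_pos rfl]

/-- Roles held by members of `T` are all roles but those outside `T`. This identity serves both the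
normalization of the probabilities and the outside weight below. -/
theorem sum_count_sub (α : ℝ) (h : List ℕ) (T : Finset ℕ) :
    ∑ i ∈ T, ((h.count i : ℝ) - α) =
      h.length - (h.filter (· ∉ T)).length - α * T.card := by
  rw [Finset.sum_sub_distrib, Finset.sum_const, nsmul_eq_mul, mul_comm α]
  congr 1
  induction h with
  | nil => simp
  | cons a h ih =>
    simp only [List.count_cons, List.length_cons, List.filter_cons]
    by_cases ha : a ∈ T
    · simp [Finset.sum_add_distrib, ih, ha]; ring
    · simp [Finset.sum_add_distrib, ih, ha]

section
variable {α θ : ℝ} (hα0 : 0 < α) (hα1 : α < 1) (hθ : -α < θ)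

include hα1 hθ in
theorem length_add_pos {h : List ℕ} (hne : h ≠ []) : 0 < (h.length : ℝ) + θ := by
  have := one_le_length hne
  linarith

include hα0 hα1 hθ in
theorem rolePr_nonneg (h : List ℕ) (i : ℕ) : 0 ≤ rolePr α θ h i := by
  unfold rolePr
  split_ifs with h1 h2 h3 h4
  · exact zero_le_one
  · exact le_rfl
  · have := one_le_count h3
    have := length_add_pos hα1 hθ h1
    apply div_nonneg <;> linarith
  · have := one_le_card h1
    have := length_add_pos hα1 hθ h1
    apply div_nonneg <;> nlinarith
  · exact le_rfl

include hα1 hθ in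
theorem sum_rolePr {h : List ℕ} (hh : IsCast h) : ∑ i ∈ cands h, rolePr α θ h i = 1 := by
  by_cases hne : h = []
  · subst hne; simp [cands, rolePr]
  · have hp := length_add_pos hα1 hθ hne
    rw [cands, Finset.sum_insert (by simpa using hh.new_notMem), rolePr_new hne hh,
      Finset.sum_congr rfl (fun i hi => rolePr_of_mem (by simpa using hi)), ← Finset.sum_div,
      sum_count_sub]
    have : (h.filter (· ∉ h.toFinset)) = [] := by simp
    rw [this]
    simp only [List.length_nil, Nat.cast_zero, sub_zero]
    rw [← add_div]
    exact (div_eq_one_iff_eq hp.ne').2 (by ring)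

-- Filling the first role cannot lower the count of `j`; it only adds one to the denominator.
include hα0 hα1 hθ in
theorem le_rolePr_append {h : List ℕ} (i : ℕ) {j : ℕ} (hj : j ∈ h) :
    ((h.count j : ℝ) - α) / (h.length + 1 + θ) ≤ rolePr α θ (h ++ [i]) j := by
  have hne : h ≠ [] := by rintro rfl; simp at hj
  have hp := length_add_pos hα1 hθ hne
  rw [rolePr_of_mem (by simp [hj])]
  simp only [List.length_append, List.length_cons, List.length_nil, Nat.cast_add, zero_add,
    Nat.cast_one]
  apply div_le_div_of_nonneg_right _ (by linarith)
  have : h.count j ≤ (h ++ [i]).count j := by simp [List.count_append]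
  have : (h.count j : ℝ) ≤ (h ++ [i]).count j := by exact_mod_cast this
  linarith

include hα0 hα1 hθ in
theorem pairPr_nonneg (h : List ℕ) (P : Set (List ℕ)) : 0 ≤ pairPr α θ h P := by
  refine Finset.sum_nonneg fun i _ => Finset.sum_nonneg fun j _ => ?_
  split_ifs
  · exact mul_nonneg (rolePr_nonneg hα0 hα1 hθ _ _) (rolePr_nonneg hα0 hα1 hθ _ _)
  · exact le_rfl

include hα1 hθ in
theorem pairPr_first {h : List ℕ} (hh : IsCast h) (T : Set ℕ) [DecidablePred (· ∈ T)] :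
    pairPr α θ h {x | ∃ i j, x = [i, j] ∧ i ∈ T} = ∑ i ∈ cands h with i ∈ T, rolePr α θ h i := by
  classical
  rw [pairPr, Finset.sum_filter]
  refine Finset.sum_congr rfl fun i hi => ?_
  by_cases hT : i ∈ T
  · simp only [hT, if_true]
    rw [Finset.sum_congr rfl (g := fun j => rolePr α θ h i * rolePr α θ (h ++ [i]) j),
      ← Finset.mul_sum, sum_rolePr hα1 hθ (hh.append hi), mul_one]
    intro j _
    rw [if_pos]
    exact ⟨i, j, rfl, hT⟩
  · rw [if_neg hT]
    refine Finset.sum_eq_zero fun j _ => if_neg ?_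
    rintro ⟨i', j', h1, h2⟩
    simp only [List.cons.injEq, and_true] at h1
    exact hT (h1.1 ▸ h2)

-- A bound for the second role that is uniform in the choice of the first survives averaging over
-- the first.
include hα0 hα1 hθ in
theorem le_pairPr_second {h : List ℕ} (hh : IsCast h) (P : Set (List ℕ)) (c : ℝ)
    (T : ℕ → Finset ℕ) (hT : ∀ i ∈ cands h, T i ⊆ cands (h ++ [i]))
    (hP : ∀ i ∈ cands h, ∀ j ∈ T i, [i, j] ∈ P)
    (hc : ∀ i ∈ cands h, c ≤ ∑ j ∈ T i, rolePr α θ (h ++ [i]) j) : c ≤ pairPr α θ h P := by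
  classical
  rw [pairPr]
  calc c = ∑ i ∈ cands h, rolePr α θ h i * c := by
        rw [← Finset.sum_mul, sum_rolePr hα1 hθ hh, one_mul]
    _ ≤ _ := by
      refine Finset.sum_le_sum fun i hi => ?_
      calc _ ≤ rolePr α θ h i * ∑ j ∈ T i, rolePr α θ (h ++ [i]) j :=
            mul_le_mul_of_nonneg_left (hc i hi) (rolePr_nonneg hα0 hα1 hθ _ _)
        _ = ∑ j ∈ T i, if [i, j] ∈ P then rolePr α θ h i * rolePr α θ (h ++ [i]) j else 0 := by
            rw [Finset.mul_sum]
            exact Finset.sum_congr rfl fun j hj => (if_pos (hP i hi j hj)).symm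
        _ ≤ _ := by
            refine Finset.sum_le_sum_of_subset_of_nonneg (hT i hi) fun j _ _ => ?_
            split_ifs
            · exact mul_nonneg (rolePr_nonneg hα0 hα1 hθ _ _) (rolePr_nonneg hα0 hα1 hθ _ _)
            · exact le_rfl

include hα1 hθ in
theorem le_pairPr_first_mem {h : List ℕ} (hh : IsCast h) {T : Finset ℕ} (hT : T ⊆ h.toFinset) :
    (∑ i ∈ T, ((h.count i : ℝ) - α)) / (h.length + θ) ≤
      pairPr α θ h {x | ∃ i j, x = [i, j] ∧ i ∈ T} := by
  have := pairPr_first hα1 hθ hh (T : Set ℕ)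
  simp only [Finset.mem_coe] at this
  rw [this, Finset.sum_div, Finset.filter_mem_eq_inter, Finset.inter_eq_right.2
    (show T ⊆ cands h from hT.trans (Finset.subset_insert _ _))]
  exact (Finset.sum_congr rfl fun i hi => (rolePr_of_mem (by simpa using hT hi)).symm).le

include hα0 hα1 hθ in
theorem le_pairPr_second_mem {h : List ℕ} (hh : IsCast h) {T : Finset ℕ} (hT : T ⊆ h.toFinset) :
    (∑ i ∈ T, ((h.count i : ℝ) - α)) / (h.length + 1 + θ) ≤
      pairPr α θ h {x | ∃ i j, x = [i, j] ∧ j ∈ T} := by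
  refine le_pairPr_second hα0 hα1 hθ hh _ _ (fun _ => T) (fun i _ => ?_) (fun i _ j hj => ⟨i, j, rfl, hj⟩)
    fun i _ => ?_
  · refine hT.trans ((Finset.subset_insert i _).trans ?_)
    rw [← toFinset_append_singleton]
    exact Finset.subset_insert _ _
  · rw [Finset.sum_div]
    exact Finset.sum_le_sum fun j hj => le_rolePr_append hα0 hα1 hθ i (by simpa using hT hj)

include hα0 hα1 hθ in
theorem le_pairPr_first_new {h : List ℕ} (hne : h ≠ []) (hh : IsCast h) :
    (θ + α * h.toFinset.card) / (h.length + θ) ≤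
      pairPr α θ h {x | ∃ i j, x = [i, j] ∧ i ∉ h} := by
  have := pairPr_first hα1 hθ hh {i | i ∉ h}
  simp only [Set.mem_ofPred_eq] at this
  rw [this, ← rolePr_new hne hh]
  refine Finset.single_le_sum (f := fun i => rolePr α θ h i)
    (fun i _ => rolePr_nonneg hα0 hα1 hθ _ _) ?_
  simpa [cands] using hh.new_notMem

include hα0 hα1 hθ in
theorem le_pairPr_second_new {h : List ℕ} (hne : h ≠ []) (hh : IsCast h) :
    (θ + α * h.toFinset.card) / (h.length + 1 + θ) ≤
      pairPr α θ h {x | ∃ i j, x = [i, j] ∧ j ∉ h ++ [i]} := by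
  refine le_pairPr_second hα0 hα1 hθ hh _ _ (fun i => {(h ++ [i]).toFinset.card + 1})
    (fun i _ => by simp [cands]) (fun i hi j hj => ⟨i, j, rfl, ?_⟩) fun i hi => ?_
  · rw [Finset.mem_singleton.1 hj]
    exact (hh.append hi).new_notMem
  · rw [Finset.sum_singleton, rolePr_new (by simp) (hh.append hi)]
    have := length_add_pos hα1 hθ hne
    simp only [List.length_append, List.length_cons, List.length_nil, Nat.cast_add, zero_add,
      Nat.cast_one]
    apply div_le_div_of_nonneg_right _ (by linarith)
    gcongr
    simp

-- Each actor already seen has weight at least `1 - α`, so the partners in `T` contribute in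
-- proportion to the size of `T`.
include hα0 hα1 hθ in
theorem le_pairPr_one {h : List ℕ} (hh : IsCast h) (h1 : 1 ∈ h) {T : Finset ℕ}
    (hT : T ⊆ h.toFinset) (P : Set (List ℕ)) (hP : ∀ j ∈ T, [1, j] ∈ P) :
    ((h.count 1 : ℝ) - α) / (h.length + θ) * (T.card * ((1 - α) / (h.length + 1 + θ))) ≤
      pairPr α θ h P := by
  classical
  have hne : h ≠ [] := by rintro rfl; simp at h1
  have hp := length_add_pos hα1 hθ hne
  have hnn : ∀ i j, 0 ≤ if [i, j] ∈ P then
      rolePr α θ h i * rolePr α θ (h ++ [i]) j else 0 := fun i j => by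
    split_ifs
    · exact mul_nonneg (rolePr_nonneg hα0 hα1 hθ _ _) (rolePr_nonneg hα0 hα1 hθ _ _)
    · exact le_rfl
  have hT' : T ⊆ cands (h ++ [1]) := by
    refine hT.trans ((Finset.subset_insert 1 _).trans ?_)
    rw [← toFinset_append_singleton]
    exact Finset.subset_insert _ _
  have h1' : 1 ∈ cands h := by
    unfold cands
    exact Finset.mem_insert_of_mem (List.mem_toFinset.2 h1)
  calc _ = ∑ j ∈ T, ((h.count 1 : ℝ) - α) / (h.length + θ) * ((1 - α) / (h.length + 1 + θ)) := by
        rw [Finset.sum_const, nsmul_eq_mul]; ring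
    _ ≤ ∑ j ∈ T, if [1, j] ∈ P then rolePr α θ h 1 * rolePr α θ (h ++ [1]) j else 0 := by
        refine Finset.sum_le_sum fun j hj => ?_
        have hjh : j ∈ h := by simpa using hT hj
        rw [if_pos (hP j hj), ← rolePr_of_mem h1]
        refine mul_le_mul_of_nonneg_left (le_trans ?_ (le_rolePr_append hα0 hα1 hθ 1 hjh))
          (rolePr_nonneg hα0 hα1 hθ _ _)
        have := one_le_count hjh
        exact div_le_div_of_nonneg_right (by linarith) (by linarith)
    _ ≤ ∑ j ∈ cands (h ++ [1]), if [1, j] ∈ P then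
          rolePr α θ h 1 * rolePr α θ (h ++ [1]) j else 0 :=
        Finset.sum_le_sum_of_subset_of_nonneg hT' fun j _ _ => hnn 1 j
    _ ≤ _ := Finset.single_le_sum (f := fun i => ∑ j ∈ cands (h ++ [i]), if [i, j] ∈ P then
          rolePr α θ h i * rolePr α θ (h ++ [i]) j else 0)
        (fun i _ => Finset.sum_nonneg fun j _ => hnn i j) h1'

end

/-! ### Event counts against accumulated conditional probabilities -/

section Counting
variable {Ω : Type*} {m0 : MeasurableSpace Ω} {μ : Measure Ω} [IsProbabilityMeasure μ]

theorem condExp_indicator_mem_Icc {m : MeasurableSpace Ω} {B : Set Ω}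
    (hB : MeasurableSet[m0] B) :
    ∀ᵐ ω ∂μ, 0 ≤ (μ[B.indicator (fun _ => (1 : ℝ)) | m]) ω ∧
      (μ[B.indicator (fun _ => (1 : ℝ)) | m]) ω ≤ 1 := by
  by_cases hm : m ≤ m0
  · have hi : Integrable (B.indicator (fun _ => (1 : ℝ))) μ := (integrable_const 1).indicator hB
    have h0 : 0 ≤ᵐ[μ] μ[B.indicator (fun _ => (1 : ℝ)) | m] :=
      condExp_nonneg (ae_of_all _ fun ω => Set.indicator_nonneg (fun _ _ => zero_le_one) ω)
    have h1 : μ[B.indicator (fun _ => (1 : ℝ)) | m] ≤ᵐ[μ] μ[(fun _ => (1 : ℝ)) | m] :=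
      condExp_mono hi (integrable_const 1)
        (ae_of_all _ fun ω => Set.indicator_le_self' (fun _ _ => zero_le_one) ω)
    rw [condExp_const hm] at h1
    filter_upwards [h0, h1] with ω a b using ⟨a, b⟩
  · simp [condExp_of_not_le hm]

/-- A nonnegative supermartingale is almost surely bounded. -/
theorem ae_bddAbove_of_supermartingale {ℱ : Filtration ℕ m0} {G : ℕ → Ω → ℝ}
    (hG : Supermartingale G ℱ μ) (h0 : ∀ n ω, 0 ≤ G n ω) :
    ∀ᵐ ω ∂μ, ∃ C, ∀ n, G n ω ≤ C := by
  have hbdd : ∀ n, eLpNorm ((-G) n) 1 μ ≤ ((∫ ω, G 0 ω ∂μ).toNNReal : ℝ≥0∞) := by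
    intro n
    rw [Pi.neg_apply, eLpNorm_neg, eLpNorm_one_eq_lintegral_enorm]
    have : ∀ ω, ‖G n ω‖ₑ = ENNReal.ofReal (G n ω) := fun ω => Real.enorm_of_nonneg (h0 n ω)
    simp_rw [this]
    rw [← ofReal_integral_eq_lintegral_ofReal (hG.integrable n) (ae_of_all _ (h0 n))]
    have := hG.setIntegral_le (Nat.zero_le n) MeasurableSet.univ
    simp only [Measure.restrict_univ] at this
    exact ENNReal.ofReal_le_ofReal this
  filter_upwards [hG.neg.exists_ae_tendsto_of_bdd hbdd] with ω ⟨c, hc⟩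
  obtain ⟨C, hC⟩ := hc.neg.bddAbove_range
  exact ⟨C, fun n => by simpa using hC ⟨n, rfl⟩⟩

/-- Counting an adapted sequence of events, the count is eventually at least a given fraction of
the sum of the conditional probabilities, up to a random constant. -/
theorem ae_exists_sum_condExp_sub_le (ℱ : Filtration ℕ m0) {B : ℕ → Set Ω}
    (hB : ∀ n, MeasurableSet[ℱ (n + 1)] (B n)) {κ : ℝ} (hκ0 : 0 < κ) (hκ1 : κ < 1) :
    ∀ᵐ ω ∂μ, ∃ C, ∀ n,
      (1 - κ) * ∑ k ∈ Finset.range n, (μ[(B k).indicator (fun _ => (1 : ℝ)) | ℱ k]) ω - C ≤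
        ∑ k ∈ Finset.range n, (B k).indicator (fun _ => (1 : ℝ)) ω := by
  set p : ℕ → Ω → ℝ := fun k => μ[(B k).indicator (fun _ => (1 : ℝ)) | ℱ k] with hp
  set b : ℕ → Ω → ℝ := fun k => (B k).indicator (fun _ => (1 : ℝ)) with hb
  -- Chosen so that `exp (-l * b) = 1 - κ * b` for `b ∈ {0, 1}`, which makes the exponential linear
  -- in the indicator.
  set l : ℝ := -Real.log (1 - κ) with hl
  have hl0 : 0 ≤ l := neg_nonneg.2 (Real.log_nonpos (by linarith) (by linarith))
  have hl1 : l ≤ κ / (1 - κ) := by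
    rw [hl, ← Real.log_inv]
    refine (Real.log_le_sub_one_of_pos (inv_pos.2 (by linarith))).trans_eq ?_
    field_simp [show (1 - κ) ≠ 0 by linarith]
    ring
  have hB' : ∀ n, MeasurableSet (B n) := fun n => ℱ.le _ _ (hB n)
  have hb0 : ∀ k ω, 0 ≤ b k ω := fun k ω => Set.indicator_nonneg (fun _ _ => zero_le_one) ω
  have hpb : ∀ᵐ ω ∂μ, ∀ k, 0 ≤ p k ω ∧ p k ω ≤ 1 :=
    ae_all_iff.2 fun k => condExp_indicator_mem_Icc (hB' k)
  have hpm : ∀ k, StronglyMeasurable[ℱ k] (p k) := fun k => stronglyMeasurable_condExp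
  have hbm : ∀ k, StronglyMeasurable[ℱ (k + 1)] (b k) := fun k =>
    stronglyMeasurable_const.indicator (hB k)
  have hbi : ∀ k, Integrable (b k) μ := fun k => (integrable_const 1).indicator (hB' k)
  let G : ℕ → Ω → ℝ := fun n ω =>
    Real.exp (κ * ∑ k ∈ Finset.range n, p k ω - l * ∑ k ∈ Finset.range n, b k ω)
  have hsm : ∀ n, StronglyMeasurable[ℱ n] fun ω => ∑ k ∈ Finset.range n, p k ω := fun n =>
    Finset.stronglyMeasurable_fun_sum _ fun k hk =>
      (hpm k).mono (ℱ.mono (Finset.mem_range.1 hk).le)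
  have hsb : ∀ n, StronglyMeasurable[ℱ n] fun ω => ∑ k ∈ Finset.range n, b k ω := fun n =>
    Finset.stronglyMeasurable_fun_sum _ fun k hk =>
      (hbm k).mono (ℱ.mono (Finset.mem_range.1 hk))
  have hGm : ∀ n, StronglyMeasurable[ℱ n] (G n) := fun n =>
    Real.continuous_exp.comp_stronglyMeasurable
      (((hsm n).const_mul κ).sub ((hsb n).const_mul l))
  have hGbd : ∀ n, ∀ᵐ ω ∂μ, ‖G n ω‖ ≤ Real.exp (κ * n) := by
    intro n
    filter_upwards [hpb] with ω hω
    rw [Real.norm_of_nonneg (Real.exp_pos _).le]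
    refine Real.exp_le_exp.2 ?_
    have h1 : ∑ k ∈ Finset.range n, p k ω ≤ n := by
      simpa using Finset.sum_le_card_nsmul (Finset.range n) (fun k => p k ω) 1
        fun k _ => (hω k).2
    have h2 : 0 ≤ ∑ k ∈ Finset.range n, b k ω := Finset.sum_nonneg fun k _ => hb0 k ω
    have := mul_nonneg hl0 h2
    have := mul_le_mul_of_nonneg_left h1 hκ0.le
    linarith
  have hGi : ∀ n, Integrable (G n) μ := fun n =>
    Integrable.of_bound ((hGm n).mono (ℱ.le n)).aestronglyMeasurable _ (hGbd n)
  -- The conditional expectation multiplies `G n` by `exp (κ p) * (1 - κ p)`, which is at most one.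
  have hsuper : Supermartingale G ℱ μ := by
    refine supermartingale_nat hGm hGi fun n => ?_
    have hdec : G (n + 1) =
        (fun ω => G n ω * Real.exp (κ * p n ω)) * (fun ω => 1 - κ * b n ω) := by
      ext ω
      have h1 : Real.exp (-(l * b n ω)) = 1 - κ * b n ω := by
        by_cases hω : ω ∈ B n
        · simp only [hb, Set.indicator_of_mem hω, hl]
          rw [mul_one, neg_neg, Real.exp_log (by linarith), mul_one]
        · simp [hb, Set.indicator_of_notMem hω]
      simp only [G, Pi.mul_apply, Finset.sum_range_succ]
      rw [← h1, ← Real.exp_add, ← Real.exp_add]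
      congr 1
      ring
    have hpull : μ[G (n + 1) | ℱ n] =ᵐ[μ] (fun ω => G n ω * Real.exp (κ * p n ω)) *
        μ[fun ω => 1 - κ * b n ω | ℱ n] := by
      rw [hdec]
      refine condExp_stronglyMeasurable_mul_of_bound (ℱ.le n)
        ((hGm n).mul (Real.continuous_exp.comp_stronglyMeasurable ((hpm n).const_mul κ)))
        ((integrable_const 1).sub ((hbi n).const_mul κ)) (Real.exp (κ * n) * Real.exp κ) ?_
      filter_upwards [hpb, hGbd n] with ω h1 h2
      rw [norm_mul]
      refine mul_le_mul h2 ?_ (norm_nonneg _) (Real.exp_pos _).le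
      rw [Real.norm_of_nonneg (Real.exp_pos _).le]
      refine Real.exp_le_exp.2 ?_
      exact mul_le_of_le_one_right hκ0.le (h1 n).2
    have hlin : μ[fun ω => 1 - κ * b n ω | ℱ n] =ᵐ[μ] fun ω => 1 - κ * p n ω := by
      have h1 := condExp_sub (integrable_const (1 : ℝ)) ((hbi n).const_mul κ) (ℱ n) (μ := μ)
      have h2 := condExp_smul κ (b n) (ℱ n) (μ := μ)
      rw [condExp_const (ℱ.le n)] at h1
      filter_upwards [h1, h2] with ω h1 h2
      exact h1.trans (by rw [Pi.sub_apply]; exact congrArg _ h2)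
    filter_upwards [hpull, hlin] with ω h1 h2
    rw [h1, Pi.mul_apply, h2, mul_assoc]
    refine mul_le_of_le_one_right (Real.exp_pos _).le ?_
    have := Real.add_one_le_exp (-(κ * p n ω))
    calc Real.exp (κ * p n ω) * (1 - κ * p n ω)
        ≤ Real.exp (κ * p n ω) * Real.exp (-(κ * p n ω)) :=
          mul_le_mul_of_nonneg_left (by linarith) (Real.exp_pos _).le
      _ = 1 := by rw [← Real.exp_add, add_neg_cancel, Real.exp_zero]
  filter_upwards [ae_bddAbove_of_supermartingale hsuper fun n ω => (Real.exp_pos _).le]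
    with ω ⟨C, hC⟩
  -- Take logarithms in `G n ≤ C`, use `l ≤ κ / (1 - κ)`, and multiply by `(1 - κ) / κ`.
  refine ⟨(1 - κ) / κ * Real.log C, fun n => ?_⟩
  have hCpos : 0 < C := (Real.exp_pos _).trans_le (hC 0)
  have h1 := (Real.le_log_iff_exp_le hCpos).2 (hC n)
  have h2 : 0 ≤ ∑ k ∈ Finset.range n, b k ω := Finset.sum_nonneg fun k _ => hb0 k ω
  have h3 := mul_le_mul_of_nonneg_right hl1 h2
  have h4 : κ * ∑ k ∈ Finset.range n, p k ω - Real.log C ≤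
      κ / (1 - κ) * ∑ k ∈ Finset.range n, b k ω := by linarith
  have h5 := mul_le_mul_of_nonneg_left h4 (show 0 ≤ (1 - κ) / κ from
    div_nonneg (by linarith) hκ0.le)
  have h6 : (1 - κ) / κ * (κ / (1 - κ) * ∑ k ∈ Finset.range n, b k ω) =
      ∑ k ∈ Finset.range n, b k ω := by
    field_simp [show (1 - κ) ≠ 0 by linarith]
  have h7 : (1 - κ) / κ * (κ * ∑ k ∈ Finset.range n, p k ω - Real.log C) =
      (1 - κ) * ∑ k ∈ Finset.range n, p k ω - (1 - κ) / κ * Real.log C := by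
    field_simp
  linarith

/-- A lower bound for a conditional probability given a discrete random variable, checked on
the atoms. -/
theorem le_condExp_comap_of_atoms {ι : Type*} [Countable ι] {Z : Ω → ι}
    (hm : MeasurableSpace.comap Z ⊤ ≤ m0) {B : Set Ω} (hB : MeasurableSet B) {g : ι → ℝ}
    (h : ∀ z, g z * μ.real (Z ⁻¹' {z}) ≤ μ.real (B ∩ Z ⁻¹' {z})) :
    ∀ᵐ ω ∂μ, g (Z ω) ≤ (μ[B.indicator (fun _ => (1 : ℝ)) | MeasurableSpace.comap Z ⊤]) ω := by
  set f := μ[B.indicator (fun _ => (1 : ℝ)) | MeasurableSpace.comap Z ⊤] with hf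
  -- The conditional expectation is constant on the atoms of `Z`, so its integral over an atom of
  -- positive mass determines its value there.
  have hfac : f.FactorsThrough Z := by
    let _ : MeasurableSpace ι := ⊤
    exact (stronglyMeasurable_condExp (m := MeasurableSpace.comap Z ⊤)).factorsThrough
  have key : ∀ z, ∀ᵐ ω ∂μ, Z ω = z → g z ≤ f ω := by
    intro z
    have hms : MeasurableSet[MeasurableSpace.comap Z ⊤] (Z ⁻¹' {z}) := ⟨{z}, trivial, rfl⟩
    by_cases h0 : μ (Z ⁻¹' {z}) = 0
    · filter_upwards [measure_eq_zero_iff_ae_notMem.1 h0] with ω hω hz using absurd hz hω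
    · refine ae_of_all _ fun ω hω => ?_
      have h1 := setIntegral_condExp hm ((integrable_const (1 : ℝ)).indicator hB) hms (μ := μ)
      rw [← hf, setIntegral_indicator hB, setIntegral_const, smul_eq_mul, mul_one,
        setIntegral_congr_fun (g := fun _ => f ω) (hm _ hms)
          (fun ω' hω' => hfac (by rw [hω]; exact hω')),
        setIntegral_const, smul_eq_mul, Set.inter_comm] at h1
      have hpos : 0 < μ.real (Z ⁻¹' {z}) :=
        ENNReal.toReal_pos h0 (measure_ne_top _ _)
      have := h z
      rw [← h1, mul_comm] at this
      exact le_of_mul_le_mul_left this hpos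
  filter_upwards [ae_all_iff.2 key] with ω hω using hω _ rfl

end Counting

/-! ### The filtration of the process and its one-step law -/

section History
variable {Ω : Type*} {X : ℕ → Ω → List ℕ}

/-- The first `n` interactions. -/
def hist (X : ℕ → Ω → List ℕ) (n : ℕ) (ω : Ω) : List (List ℕ) := List.ofFn fun i : Fin n => X i ω

/-- The actors cast in the first `n` interactions, in order. -/
def roles (X : ℕ → Ω → List ℕ) (n : ℕ) (ω : Ω) : List ℕ := (hist X n ω).flatten

theorem hist_succ (n : ℕ) (ω : Ω) : hist X (n + 1) ω = hist X n ω ++ [X n ω] := by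
  rw [hist, List.ofFn_succ_last]
  rfl

theorem roles_succ (n : ℕ) (ω : Ω) : roles X (n + 1) ω = roles X n ω ++ X n ω := by
  simp [roles, hist_succ]

theorem roles_zero (ω : Ω) : roles X 0 ω = [] := by simp [roles, hist]

theorem length_hist (n : ℕ) (ω : Ω) : (hist X n ω).length = n := by simp [hist]

theorem mem_hist {n : ℕ} {ω : Ω} {x : List ℕ} : x ∈ hist X n ω ↔ ∃ k < n, X k ω = x := by
  simp only [hist, List.mem_ofFn]
  exact ⟨fun ⟨i, hi⟩ => ⟨i, i.2, hi⟩, fun ⟨k, hk, h⟩ => ⟨⟨k, hk⟩, h⟩⟩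

theorem hist_eq_take {m n : ℕ} (hmn : m ≤ n) (ω : Ω) : hist X m ω = (hist X n ω).take m := by
  induction n, hmn using Nat.le_induction with
  | base => rw [List.take_of_length_le (length_hist m ω).le]
  | succ n hmn ih =>
    rw [hist_succ, List.take_append_of_le_length (by rw [length_hist]; exact hmn), ← ih]

theorem hist_eq_ofFn_iff {n : ℕ} {ω : Ω} {h : Fin n → List ℕ} :
    hist X n ω = List.ofFn h ↔ ∀ i : Fin n, X i ω = h i := by
  rw [hist, List.ofFn_injective.eq_iff, funext_iff]

variable [mΩ : MeasurableSpace Ω]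

theorem comap_hist_le (hX : ∀ n x, MeasurableSet {ω | X n ω = x}) (n : ℕ) :
    MeasurableSpace.comap (hist X n) ⊤ ≤ mΩ := by
  rintro _ ⟨S, -, rfl⟩
  have : hist X n ⁻¹' S = ⋃ z ∈ S, hist X n ⁻¹' {z} := by ext; simp
  rw [this]
  refine MeasurableSet.biUnion S.to_countable fun z _ => ?_
  by_cases hz : z.length = n
  · subst hz
    have : hist X z.length ⁻¹' {z} = ⋂ i : Fin z.length, {ω | X i ω = z.get i} := by
      ext ω
      simp only [Set.mem_preimage, Set.mem_singleton_iff, Set.mem_iInter, Set.mem_ofPred_eq]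
      rw [← hist_eq_ofFn_iff, List.ofFn_get]
    rw [this]
    exact MeasurableSet.iInter fun i => hX _ _
  · have : hist X n ⁻¹' {z} = ∅ := by
      ext ω
      simp only [Set.mem_preimage, Set.mem_singleton_iff, Set.mem_empty_iff_false, iff_false]
      rintro rfl
      exact hz (length_hist n ω)
    rw [this]
    exact MeasurableSet.empty

/-- The filtration generated by the interactions. -/
def histFiltration (hX : ∀ n x, MeasurableSet {ω | X n ω = x}) : Filtration ℕ mΩ where
  seq n := MeasurableSpace.comap (hist X n) ⊤
  mono' m n hmn := by
    rintro _ ⟨S, -, rfl⟩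
    exact ⟨{z | z.take m ∈ S}, trivial, by ext ω; simp [hist_eq_take hmn]⟩
  le' := comap_hist_le hX

theorem measurableSet_next (hX : ∀ n x, MeasurableSet {ω | X n ω = x}) (n : ℕ)
    (P : List (List ℕ) → Set (List ℕ)) :
    MeasurableSet[histFiltration hX (n + 1)] {ω | X n ω ∈ P (hist X n ω)} := by
  refine ⟨{z | ∃ h x, z = h ++ [x] ∧ x ∈ P h}, trivial, ?_⟩
  ext ω
  simp only [Set.mem_preimage, Set.mem_ofPred_eq, hist_succ]
  constructor
  · rintro ⟨h, x, he, hx⟩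
    obtain ⟨h1, h2⟩ := List.append_inj' he rfl
    simp only [List.cons.injEq, and_true] at h2
    rwa [h1, h2]
  · exact fun h => ⟨_, _, rfl, h⟩

theorem stronglyMeasurable_comp_hist (hX : ∀ n x, MeasurableSet {ω | X n ω = x}) (n : ℕ)
    (f : List (List ℕ) → ℝ) :
    StronglyMeasurable[histFiltration hX n] fun ω => f (hist X n ω) := by
  have h : Measurable[histFiltration hX n] fun ω => f (hist X n ω) :=
    fun s _ => ⟨f ⁻¹' s, trivial, rfl⟩
  exact h.stronglyMeasurable

variable {μ : Measure Ω} {α θ : ℝ} {ν : PMF ℕ}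

theorem IsHollywoodProcess.measure_inter_eq (hX : IsHollywoodProcess μ α θ ν X) {n : ℕ}
    {h : List (List ℕ)} (hn : h.length = n) (x : List ℕ) :
    μ ({ω | X n ω = x} ∩ hist X n ⁻¹' {h}) =
      μ (hist X n ⁻¹' {h}) * (ν x.length * ENNReal.ofReal (castPr α θ h.flatten x)) := by
  subst hn
  have := hX.step h.length h.get x
  simp_rw [← hist_eq_ofFn_iff, List.ofFn_get] at this
  rw [Set.inter_comm]
  exact this

/-- There are only countably many pairs of a history and a next interaction, and each forbidden pair
has probability zero. -/
theorem ae_next (hX : IsHollywoodProcess μ α θ ν X) (hν : ν 2 = 1) :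
    ∀ᵐ ω ∂μ, ∀ n, ∃ i j, X n ω = [i, j] ∧ i ∈ cands (roles X n ω) ∧
      j ∈ cands (roles X n ω ++ [i]) := by
  rw [ae_all_iff]
  intro n
  have key : ∀ h x, ∀ᵐ ω ∂μ, hist X n ω = h → X n ω = x → ∃ i j, x = [i, j] ∧
      i ∈ cands h.flatten ∧ j ∈ cands (h.flatten ++ [i]) := by
    intro h x
    by_cases hg : ∃ i j, x = [i, j] ∧ i ∈ cands h.flatten ∧ j ∈ cands (h.flatten ++ [i])
    · exact ae_of_all _ fun _ _ _ => hg
    by_cases hn : h.length = n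
    · have hz : μ ({ω | X n ω = x} ∩ hist X n ⁻¹' {h}) = 0 := by
        rw [hX.measure_inter_eq hn]
        by_cases hx : x.length = 2
        · obtain ⟨i, j, rfl⟩ := List.length_eq_two.1 hx
          have : castPr α θ h.flatten [i, j] = 0 := by
            by_contra hne
            simp only [castPr, mul_one, mul_eq_zero, not_or] at hne
            exact hg ⟨i, j, rfl, mem_cands_of_rolePr_ne_zero hne.1,
              mem_cands_of_rolePr_ne_zero hne.2⟩
          simp [this]
        · have : ν x.length = 0 := by
            have hs := (PMF.apply_eq_one_iff ν 2).1 hν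
            rw [PMF.apply_eq_zero_iff, hs]
            exact hx
          simp [this]
      filter_upwards [measure_eq_zero_iff_ae_notMem.1 hz] with ω hω h1 h2
      exact absurd ⟨h2, h1⟩ hω
    · exact ae_of_all _ fun ω h1 => absurd (h1 ▸ length_hist n ω) hn
  have := ae_all_iff.2 fun h => ae_all_iff.2 (key h)
  filter_upwards [this] with ω hω
  exact hω _ _ rfl rfl

theorem ae_isCast (hX : IsHollywoodProcess μ α θ ν X) (hν : ν 2 = 1) :
    ∀ᵐ ω ∂μ, ∀ n, IsCast (roles X n ω) ∧ (roles X n ω).length = 2 * n := by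
  filter_upwards [ae_next hX hν] with ω hω n
  induction n with
  | zero => simp [roles_zero, isCast_nil]
  | succ n ih =>
    obtain ⟨i, j, hx, hi, hj⟩ := hω n
    rw [roles_succ, hx]
    refine ⟨?_, by simp [ih.2]; ring⟩
    have := (ih.1.append hi).append hj
    simpa using this

/-- A lower bound is enough: upper bounds are later obtained by passing to complementary events. -/
theorem le_condExp_next [IsProbabilityMeasure μ] (hα0 : 0 < α) (hα1 : α < 1) (hθ : -α < θ)
    (hX : IsHollywoodProcess μ α θ ν X) (hν : ν 2 = 1) (n : ℕ)
    (P : List (List ℕ) → Set (List ℕ)) :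
    ∀ᵐ ω ∂μ, pairPr α θ (roles X n ω) (P (hist X n ω)) ≤
      (μ[{ω | X n ω ∈ P (hist X n ω)}.indicator (fun _ => (1 : ℝ)) |
        histFiltration hX.measurableSet_eq n]) ω := by
  classical
  have hms := (histFiltration hX.measurableSet_eq).le _ _
    (measurableSet_next hX.measurableSet_eq n P)
  refine le_condExp_comap_of_atoms (comap_hist_le hX.measurableSet_eq n) hms
    (g := fun h => pairPr α θ h.flatten (P h)) fun h => ?_
  by_cases hn : h.length = n
  swap
  · have : hist X n ⁻¹' {h} = ∅ := by
      ext ω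
      simp only [Set.mem_preimage, Set.mem_singleton_iff, Set.mem_empty_iff_false, iff_false]
      rintro rfl
      exact hn (length_hist n ω)
    simp [this]
  have hA : MeasurableSet (hist X n ⁻¹' {h}) :=
    comap_hist_le hX.measurableSet_eq n _ ⟨{h}, trivial, rfl⟩
  have hval : ∀ i j, rolePr α θ h.flatten i * rolePr α θ (h.flatten ++ [i]) j *
      μ.real (hist X n ⁻¹' {h}) = μ.real ({ω | X n ω = [i, j]} ∩ hist X n ⁻¹' {h}) := by
    intro i j
    rw [measureReal_def, measureReal_def, hX.measure_inter_eq hn]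
    simp only [List.length_cons, List.length_nil, zero_add, Nat.reduceAdd, hν, one_mul,
      ENNReal.toReal_mul, castPr, mul_one]
    rw [ENNReal.toReal_ofReal (mul_nonneg (rolePr_nonneg hα0 hα1 hθ _ _)
      (rolePr_nonneg hα0 hα1 hθ _ _)), mul_comm]
  let F : Finset (Σ _ : ℕ, ℕ) :=
    ((cands h.flatten).sigma fun i => cands (h.flatten ++ [i])).filter fun p => [p.1, p.2] ∈ P h
  calc pairPr α θ h.flatten (P h) * μ.real (hist X n ⁻¹' {h})
      = ∑ p ∈ F, μ.real ({ω | X n ω = [p.1, p.2]} ∩ hist X n ⁻¹' {h}) := by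
        rw [pairPr, Finset.sum_filter, Finset.sum_sigma, Finset.sum_mul]
        refine Finset.sum_congr rfl fun i _ => ?_
        rw [Finset.sum_mul]
        refine Finset.sum_congr rfl fun j _ => ?_
        rw [ite_mul, zero_mul, hval]
    _ = μ.real (⋃ p ∈ F, {ω | X n ω = [p.1, p.2]} ∩ hist X n ⁻¹' {h}) := by
        rw [measureReal_biUnion_finset]
        · rintro ⟨i, j⟩ _ ⟨i', j'⟩ _ hne
          refine Set.disjoint_left.2 ?_
          rintro ω ⟨h1, -⟩ ⟨h2, -⟩
          simp only [Set.mem_ofPred_eq] at h1 h2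
          rw [h1] at h2
          simp only [List.cons.injEq, and_true] at h2
          exact hne (by rw [h2.1, h2.2])
        · exact fun p _ => (hX.measurableSet_eq _ _).inter hA
    _ ≤ _ := by
        refine measureReal_mono ?_
        refine Set.iUnion₂_subset fun p hp => ?_
        rintro ω ⟨h1, h2⟩
        refine ⟨?_, h2⟩
        simp only [Set.mem_ofPred_eq, Set.mem_preimage, Set.mem_singleton_iff] at h1 h2 ⊢
        rw [h1, h2]
        exact (Finset.mem_filter.1 hp).2

/-- The count of a history-dependent sequence of events dominates the accumulated conditional
probabilities, up to a factor close to one and a random constant. -/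
theorem ae_exists_sum_pairPr_sub_le [IsProbabilityMeasure μ] (hα0 : 0 < α) (hα1 : α < 1)
    (hθ : -α < θ) (hX : IsHollywoodProcess μ α θ ν X) (hν : ν 2 = 1)
    (P : List (List ℕ) → Set (List ℕ)) {κ : ℝ} (hκ0 : 0 < κ) (hκ1 : κ < 1) :
    ∀ᵐ ω ∂μ, ∃ C, ∀ n,
      (1 - κ) * ∑ k ∈ Finset.range n, pairPr α θ (roles X k ω) (P (hist X k ω)) - C ≤
        ∑ k ∈ Finset.range n, {ω | X k ω ∈ P (hist X k ω)}.indicator (fun _ => (1 : ℝ)) ω := by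
  filter_upwards [ae_exists_sum_condExp_sub_le (μ := μ) (histFiltration hX.measurableSet_eq)
    (fun n => measurableSet_next hX.measurableSet_eq n P) hκ0 hκ1,
    ae_all_iff.2 fun n => le_condExp_next hα0 hα1 hθ hX hν n P] with ω ⟨C, hC⟩ hω
  refine ⟨C, fun n => le_trans ?_ (hC n)⟩
  refine sub_le_sub_right (mul_le_mul_of_nonneg_left ?_ (by linarith)) _
  exact Finset.sum_le_sum fun k _ => hω k

end History

/-! ### Deterministic growth lemmas -/

theorem eventually_rpow_le_mul_rpow_sub {β β' c : ℝ} (hβ : β < β') (hβ' : 0 < β') (hc : 0 < c)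
    (C : ℝ) : ∀ᶠ n : ℕ in atTop, (n : ℝ) ^ β ≤ c * (n : ℝ) ^ β' - C := by
  have h1 : Tendsto (fun n : ℕ => (n : ℝ) ^ (-(β' - β))) atTop (nhds 0) :=
    (tendsto_rpow_neg_atTop (by linarith)).comp tendsto_natCast_atTop_atTop
  have h2 : Tendsto (fun n : ℕ => (n : ℝ) ^ β') atTop atTop :=
    (tendsto_rpow_atTop hβ').comp tendsto_natCast_atTop_atTop
  filter_upwards [h1.eventually (gt_mem_nhds (half_pos hc)), h2.eventually_ge_atTop (2 * C / c),
    eventually_gt_atTop 0] with n h1 h2 hn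
  have hn' : (0 : ℝ) < n := by exact_mod_cast hn
  have hp := Real.rpow_pos_of_pos hn' β'
  have h3 : (n : ℝ) ^ β = (n : ℝ) ^ (-(β' - β)) * (n : ℝ) ^ β' := by
    rw [← Real.rpow_add hn']; congr 1; ring
  rw [div_le_iff₀ hc] at h2
  rw [h3]
  nlinarith

/-- Bernoulli's inequality `(1 + 1/n) ^ β ≤ 1 + β/n` shows that `n ^ β` grows no faster per step
than `u`. -/
theorem exists_mul_rpow_le_of_mul_le {u : ℕ → ℝ} {β : ℝ} {n₀ : ℕ} (hn₀ : 0 < n₀) (hβ0 : 0 ≤ β)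
    (hβ1 : β ≤ 1) (hpos : 0 < u n₀) (hu : ∀ n ≥ n₀, u n * (1 + β / n) ≤ u (n + 1)) :
    ∃ c > 0, ∀ n ≥ n₀, c * (n : ℝ) ^ β ≤ u n := by
  have hp : (0 : ℝ) < (n₀ : ℝ) ^ β := Real.rpow_pos_of_pos (by exact_mod_cast hn₀) β
  refine ⟨u n₀ / (n₀ : ℝ) ^ β, div_pos hpos hp, fun n hn => ?_⟩
  induction n, hn using Nat.le_induction with
  | base => rw [div_mul_cancel₀ _ hp.ne']
  | succ n hn ih =>
    have hn' : (0 : ℝ) < n := by exact_mod_cast hn₀.trans_le hn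
    have h1 : ((n + 1 : ℕ) : ℝ) = n * (1 + 1 / n) := by push_cast; field_simp
    have h2 : (1 + 1 / (n : ℝ)) ^ β ≤ 1 + β * (1 / n) :=
      rpow_one_add_le_one_add_mul_self (by linarith [one_div_pos.2 hn']) hβ0 hβ1
    have hun : 0 ≤ u n := le_trans (by positivity) ih
    rw [h1, Real.mul_rpow hn'.le (by positivity), ← mul_assoc]
    refine le_trans (mul_le_mul ih h2 (by positivity) hun) ?_
    rw [mul_one_div]
    exact hu n hn

/-- Comparison with the harmonic series. -/
theorem tendsto_sum_of_div_le {q : ℕ → ℝ} {κ d : ℝ} (hκ : 0 < κ) (hd : 0 ≤ d) (hq0 : ∀ k, 0 ≤ q k)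
    (hq : ∀ k ≥ 1, κ / (k + d) ≤ q k) :
    Tendsto (fun n => ∑ k ∈ Finset.range n, q k) atTop atTop := by
  rw [← not_summable_iff_tendsto_nat_atTop_of_nonneg hq0]
  intro hs
  have h1 : Summable fun k : ℕ => κ / (1 + d) * (1 / ((k + 1 : ℕ) : ℝ)) := by
    refine Summable.of_nonneg_of_le (fun k => by positivity) (fun k => ?_)
      ((summable_nat_add_iff 1).2 hs)
    refine le_trans ?_ (hq (k + 1) (by omega))
    rw [div_mul_div_comm, mul_one]
    refine div_le_div_of_nonneg_left hκ.le (by positivity) ?_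
    push_cast
    nlinarith [(Nat.cast_nonneg k : (0 : ℝ) ≤ k)]
  rw [summable_mul_left_iff (by positivity)] at h1
  exact Real.not_summable_one_div_natCast ((summable_nat_add_iff 1).1 h1)

/-- A counting sequence whose intensity at time `k` is at least about `a N k / k` grows at least
like `n ^ a`, up to an arbitrarily small loss in the exponent. -/
theorem eventually_rpow_le_of_intensity {N q : ℕ → ℝ} {a b κ₀ d : ℝ} (ha0 : 0 < a) (ha1 : a ≤ 1)
    (hκ₀ : 0 < κ₀) (hd : 0 ≤ d) (hN : ∀ k ≥ 1, κ₀ ≤ a * N k + b) (hq0 : ∀ k, 0 ≤ q k)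
    (hq : ∀ k ≥ 1, (a * N k + b) / (k + d) ≤ q k)
    (hsum : ∀ m : ℕ, ∃ C, ∀ n, (1 - 1 / ((m : ℝ) + 2)) * ∑ k ∈ Finset.range n, q k - C ≤ N n)
    {β : ℝ} (hβ : β < a) :
    ∀ᶠ n : ℕ in atTop, (n : ℝ) ^ β ≤ N n := by
  have hS := tendsto_sum_of_div_le hκ₀ hd hq0 fun k hk =>
    (div_le_div_of_nonneg_right (hN k hk) (by positivity)).trans (hq k hk)
  obtain ⟨β', h1, h2⟩ := exists_between (max_lt hβ ha0)
  have hβ' : β < β' := (le_max_left _ _).trans_lt h1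
  have hβ'0 : 0 < β' := (le_max_right _ _).trans_lt h1
  -- The gap `a - β'` is split: one quarter pays for `κ`, one quarter for the constants `C` and `b`
  -- (as `S` diverges), and half for the shift `d`.
  obtain ⟨m, hm⟩ := exists_nat_one_div_lt (show 0 < (a - β') / (4 * a) from
    div_pos (by linarith) (by linarith))
  set κ : ℝ := 1 / ((m : ℝ) + 2) with hκ
  have hκpos : 0 < κ := by positivity
  have hκa : κ * a ≤ (a - β') / 4 := by
    have h3 : κ ≤ 1 / ((m : ℝ) + 1) := one_div_le_one_div_of_le (by positivity) (by linarith)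
    have h4 : (a - β') / (4 * a) * a = (a - β') / 4 := by field_simp
    nlinarith
  have hκ1 : κ < 1 := by
    rw [hκ, div_lt_one (by positivity)]
    linarith [(Nat.cast_nonneg m : (0 : ℝ) ≤ m)]
  obtain ⟨C, hC⟩ := hsum m
  set S : ℕ → ℝ := fun n => ∑ k ∈ Finset.range n, q k with hSdef
  -- The bounds close on the accumulated intensity `S` rather than on `N`: since `N ≥ (1 - κ) S -
  -- C`, the increment `q n` is at least `β' * S n / n`.
  have hev : ∀ᶠ n : ℕ in atTop, 0 < S n ∧ S n * (1 + β' / n) ≤ S (n + 1) := by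
    filter_upwards [hS.eventually_ge_atTop ((a * C - b) / ((a - β') / 4)),
      hS.eventually_gt_atTop 0, eventually_ge_atTop 1,
      tendsto_natCast_atTop_atTop.eventually_ge_atTop (β' * d / ((a - β') / 2))]
      with n e1 e2 e3 e4
    refine ⟨e2, ?_⟩
    have hn : (1 : ℝ) ≤ n := by exact_mod_cast e3
    rw [div_le_iff₀ (by linarith)] at e1 e4
    have e5 : S (n + 1) = S n + q n := Finset.sum_range_succ _ _
    have e6 : (a - (a - β') / 2) * S n ≤ a * N n + b := by
      have := mul_le_mul_of_nonneg_left (hC n) ha0.le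
      have h7 : a * ((1 - κ) * S n - C) = a * S n - κ * a * S n - a * C := by ring
      have h8 := mul_le_mul_of_nonneg_right hκa e2.le
      change a * ((1 - κ) * S n - C) ≤ a * N n at this
      change a * C - b ≤ S n * _ at e1
      linarith
    have e7 : β' * S n / n ≤ q n := by
      refine le_trans ?_ (hq n e3)
      rw [div_le_div_iff₀ (by linarith) (by linarith)]
      have := mul_le_mul_of_nonneg_right e6 (show (0 : ℝ) ≤ n by linarith)
      have := mul_le_mul_of_nonneg_left e4 e2.le
      nlinarith
    have e8 : S n * (1 + β' / n) = S n + β' * S n / n := by ring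
    linarith
  obtain ⟨n₀, hn₀⟩ := eventually_atTop.1 (hev.and (eventually_gt_atTop 0))
  obtain ⟨c, hc, hcS⟩ := exists_mul_rpow_le_of_mul_le (hn₀ n₀ le_rfl).2 hβ'0.le (by linarith)
    (hn₀ n₀ le_rfl).1.1 fun n hn => (hn₀ n hn).1.2
  have h1κ : 0 < 1 - κ := by linarith
  filter_upwards [eventually_ge_atTop n₀,
    eventually_rpow_le_mul_rpow_sub hβ' hβ'0 (mul_pos h1κ hc) C] with n h1 h2
  have h3 := mul_le_mul_of_nonneg_left (hcS n h1) h1κ.le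
  have h4 := hC n
  change (1 - κ) * S n - C ≤ N n at h4
  linarith

/-- If `M` grows like `n ^ α` and each of the `M k - M' k` individuals not yet counted by `M'`
gets counted with intensity about `1 / k`, then `M'` grows like `n ^ α`. -/
theorem eventually_rpow_le_of_transfer {M M' r q : ℕ → ℝ} {α : ℝ} (hα : 0 < α)
    (hM : ∀ β < α, ∀ᶠ n : ℕ in atTop, (n : ℝ) ^ β ≤ M n) (hM' : Monotone M')
    (hr : ∀ ε : ℝ, 0 < ε → ∀ᶠ n : ℕ in atTop, (n : ℝ) ^ (-1 - ε) ≤ r n) (hq0 : ∀ k, 0 ≤ q k)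
    (hq : ∀ k ≥ 1, r k * (M k - M' k) ≤ q k)
    (hsum : ∃ C, ∀ n, 1 / 2 * ∑ k ∈ Finset.range n, q k - C ≤ M' n) {β : ℝ} (hβ : β < α) :
    ∀ᶠ n : ℕ in atTop, (n : ℝ) ^ β ≤ M' n := by
  obtain ⟨β₁, h1, h2⟩ := exists_between (max_lt hβ hα)
  have hβ₁ : β < β₁ := (le_max_left _ _).trans_lt h1
  have hβ₁0 : 0 < β₁ := (le_max_right _ _).trans_lt h1
  set ε : ℝ := (α - β₁) / 2 with hε
  have hε0 : 0 < ε := by rw [hε]; linarith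
  obtain ⟨C, hC⟩ := hsum
  obtain ⟨k₀, hk₀⟩ := eventually_atTop.1 ((hM (β₁ + ε) (by rw [hε]; linarith)).and
    ((hr ε hε0).and (eventually_ge_atTop 1)))
  have hC0 : -M' 0 ≤ C := by have := hC 0; simp at this; linarith
  -- The quarter combines the `1 / 2` in `hsum` with the fraction `M k / 2` still uncounted; the
  -- power of `3` comes from `k ≤ 3 * m` on the window.
  set c : ℝ := 1 / 4 * (3 : ℝ) ^ (-1 - ε) with hc
  have hcpos : 0 < c := by positivity
  have hc1 : c ≤ 1 / 4 := by
    have : (3 : ℝ) ^ (-1 - ε) ≤ 1 := Real.rpow_le_one_of_one_le_of_nonpos (by norm_num) (by linarith)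
    linarith
  have key : ∀ m n : ℕ, k₀ ≤ m → 2 * m ≤ n → n ≤ 3 * m → c * (m : ℝ) ^ β₁ - max C 0 ≤ M' n := by
    intro m n hm h2m h3m
    have hm1 : (1 : ℝ) ≤ m := by exact_mod_cast (hk₀ m hm).2.2
    have hm0 : (0 : ℝ) < m := by linarith
    have hmono : (m : ℝ) ^ β₁ ≤ (m : ℝ) ^ (β₁ + ε) :=
      Real.rpow_le_rpow_of_exponent_le hm1 (by linarith)
    have hmp : 0 < (m : ℝ) ^ β₁ := by positivity
    -- Either `M'` exceeds half of `M` somewhere in the window, and monotonicity finishes, or at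
    -- least half remains uncounted throughout and the intensity over at least `m` steps suffices.
    by_cases hcase : ∃ k, m ≤ k ∧ k < n ∧ M k / 2 < M' k
    · obtain ⟨k, hmk, hkn, hk⟩ := hcase
      have h3 : (m : ℝ) ^ (β₁ + ε) ≤ (k : ℝ) ^ (β₁ + ε) :=
        Real.rpow_le_rpow hm0.le (by exact_mod_cast hmk) (by linarith)
      have h4 := (hk₀ k (hm.trans hmk)).1
      have h5 := hM' hkn.le
      have h6 := le_max_right C 0
      nlinarith
    · push Not at hcase
      have h3 : ∑ k ∈ Finset.Ico m n, q k ≤ ∑ k ∈ Finset.range n, q k := by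
        refine Finset.sum_le_sum_of_subset_of_nonneg (fun k hk => ?_) fun k _ _ => hq0 k
        simp at hk ⊢; omega
      have h4 : ∀ k ∈ Finset.Ico m n, ((3 : ℝ) * m) ^ (-1 - ε) * ((m : ℝ) ^ (β₁ + ε) / 2) ≤ q k := by
        intro k hk
        rw [Finset.mem_Ico] at hk
        obtain ⟨g1, g2, g3⟩ := hk₀ k (hm.trans hk.1)
        refine le_trans ?_ (hq k g3)
        have hk0 : (0 : ℝ) < k := by exact_mod_cast g3
        have g4 : ((3 : ℝ) * m) ^ (-1 - ε) ≤ (k : ℝ) ^ (-1 - ε) :=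
          Real.rpow_le_rpow_of_nonpos hk0 (by exact_mod_cast hk.2.le.trans h3m) (by linarith)
        have g5 : (m : ℝ) ^ (β₁ + ε) ≤ (k : ℝ) ^ (β₁ + ε) :=
          Real.rpow_le_rpow hm0.le (by exact_mod_cast hk.1) (by linarith)
        have g6 := hcase k hk.1 hk.2
        exact mul_le_mul (g4.trans g2) (by linarith) (by positivity)
          (le_trans (by positivity) g2)
      have h5 := Finset.card_nsmul_le_sum _ _ _ h4
      rw [Nat.card_Ico, nsmul_eq_mul] at h5
      have h6 : (m : ℝ) ≤ ((n - m : ℕ) : ℝ) := by exact_mod_cast (by omega : m ≤ n - m)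
      have h7 : (m : ℝ) * (((3 : ℝ) * m) ^ (-1 - ε) * ((m : ℝ) ^ (β₁ + ε) / 2)) =
          2 * (c * (m : ℝ) ^ β₁) := by
        have e1 : (m : ℝ) ^ β₁ = m * ((m : ℝ) ^ (-1 - ε) * (m : ℝ) ^ (β₁ + ε)) := by
          rw [← Real.rpow_add hm0, ← Real.rpow_one_add' hm0.le]
          · congr 1; ring
          · ring_nf; exact hβ₁0.ne'
        rw [Real.mul_rpow (by norm_num) hm0.le, e1, hc]
        ring
      have h8 := mul_le_mul_of_nonneg_right h6
        (show 0 ≤ ((3 : ℝ) * m) ^ (-1 - ε) * ((m : ℝ) ^ (β₁ + ε) / 2) by positivity)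
      have h9 := hC n
      have := le_max_left C 0
      linarith
  filter_upwards [eventually_ge_atTop (2 * k₀ + 2), eventually_rpow_le_mul_rpow_sub hβ₁ hβ₁0
    (mul_pos hcpos (show 0 < (1 / 3 : ℝ) ^ β₁ by positivity)) (max C 0)] with n hn h3
  have h4 := key (n / 2) n (by omega) (by omega) (by omega)
  have h5 : (1 / 3 : ℝ) * n ≤ ((n / 2 : ℕ) : ℝ) := by
    have : (n : ℝ) ≤ 3 * ((n / 2 : ℕ) : ℝ) := by exact_mod_cast (by omega : n ≤ 3 * (n / 2))
    linarith
  have h6 : ((1 / 3 : ℝ) * n) ^ β₁ ≤ ((n / 2 : ℕ) : ℝ) ^ β₁ :=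
    Real.rpow_le_rpow (by positivity) h5 hβ₁0.le
  rw [Real.mul_rpow (by norm_num) (by positivity)] at h6
  have := mul_le_mul_of_nonneg_left h6 hcpos.le
  linarith

/-! ### Pathwise lower bounds: actors, degree of actor `1`, repeated partners -/

section Lower
variable {Ω : Type*} {X : ℕ → Ω → List ℕ} [MeasurableSpace Ω] {μ : Measure Ω}
  [IsProbabilityMeasure μ] {α θ : ℝ} {ν : PMF ℕ}

omit [MeasurableSpace Ω] in
theorem roles_ne_nil {n : ℕ} (hn : 1 ≤ n) {ω : Ω} (h : (roles X n ω).length = 2 * n) :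
    roles X n ω ≠ [] := by
  rw [← List.length_pos_iff]; omega

theorem IsCast.one_mem {h : List ℕ} (hh : IsCast h) (hne : h ≠ []) : 1 ∈ h := by
  rw [← List.mem_toFinset, hh, Finset.mem_Icc]
  refine ⟨le_rfl, ?_⟩
  rw [Nat.one_le_iff_ne_zero, Ne, Finset.card_eq_zero]
  simpa using hne

/-- Growth of a counting process that is driven by one event for each of the two roles. -/
theorem ae_rpow_le_of_two_events (hα0 : 0 < α) (hα1 : α < 1) (hθ : -α < θ)
    (hX : IsHollywoodProcess μ α θ ν X) (hν : ν 2 = 1) {N : List (List ℕ) → ℝ} {a b κ₀ : ℝ}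
    (ha0 : 0 < a) (ha1 : a ≤ 1) (hκ₀ : 0 < κ₀) (P₁ P₂ : List (List ℕ) → Set (List ℕ))
    (hN0 : 0 ≤ N [])
    (hN : ∀ᵐ ω ∂μ, ∀ n,
      N (hist X n ω) + {ω | X n ω ∈ P₁ (hist X n ω)}.indicator (fun _ => (1 : ℝ)) ω +
        {ω | X n ω ∈ P₂ (hist X n ω)}.indicator (fun _ => (1 : ℝ)) ω ≤ N (hist X (n + 1) ω))
    (hpos : ∀ h, IsCast h.flatten → h.flatten ≠ [] → κ₀ ≤ a * N h + b)
    (h₁ : ∀ h, IsCast h.flatten → h.flatten ≠ [] →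
      (a * N h + b) / (h.flatten.length + θ) ≤ pairPr α θ h.flatten (P₁ h))
    (h₂ : ∀ h, IsCast h.flatten → h.flatten ≠ [] →
      (a * N h + b) / (h.flatten.length + 1 + θ) ≤ pairPr α θ h.flatten (P₂ h)) :
    ∀ᵐ ω ∂μ, ∀ β < a, ∀ᶠ n : ℕ in atTop, (n : ℝ) ^ β ≤ N (hist X n ω) := by
  have hκ : ∀ m : ℕ, 0 < 1 / ((m : ℝ) + 2) ∧ 1 / ((m : ℝ) + 2) < 1 := fun m => by
    refine ⟨by positivity, ?_⟩
    rw [div_lt_one (by positivity)]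
    linarith [(Nat.cast_nonneg m : (0 : ℝ) ≤ m)]
  have hs := fun P => ae_all_iff.2 fun m : ℕ =>
    ae_exists_sum_pairPr_sub_le hα0 hα1 hθ hX hν P (hκ m).1 (hκ m).2
  filter_upwards [hs P₁, hs P₂, hN, ae_isCast hX hν] with ω hs₁ hs₂ hN hc β hβ
  -- Two roles per interaction give intensity at least `2 / (2 * k + 1 + θ) = 1 / (k + (1 + θ) / 2)`
  -- times the weight, hence this `d`.
  refine eventually_rpow_le_of_intensity (a := a) (b := b) (κ₀ := κ₀) (d := (1 + θ) / 2)
    (N := fun n => N (hist X n ω))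
    (q := fun k => pairPr α θ (roles X k ω) (P₁ (hist X k ω)) +
      pairPr α θ (roles X k ω) (P₂ (hist X k ω))) ha0 ha1 hκ₀ (by linarith) ?_ ?_ ?_ ?_ hβ
  · exact fun k hk => hpos _ (hc k).1 (roles_ne_nil hk (hc k).2)
  · exact fun k => add_nonneg (pairPr_nonneg hα0 hα1 hθ _ _) (pairPr_nonneg hα0 hα1 hθ _ _)
  · intro k hk
    have hne := roles_ne_nil hk (hc k).2
    have e0 := hpos _ (hc k).1 hne
    have e1 := h₁ _ (hc k).1 hne
    have e2 := h₂ _ (hc k).1 hne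
    have e3 := length_add_pos hα1 hθ hne
    change _ ≤ pairPr α θ (roles X k ω) _ at e1 e2
    change (_ / (((roles X k ω).length : ℝ) + θ)) ≤ _ at e1
    change (_ / (((roles X k ω).length : ℝ) + 1 + θ)) ≤ _ at e2
    rw [(hc k).2] at e1 e2 e3
    push_cast at e1 e2 e3
    have e4 : (a * N (hist X k ω) + b) / (2 * k + 1 + θ) ≤
        (a * N (hist X k ω) + b) / (2 * k + θ) :=
      div_le_div_of_nonneg_left (by linarith) e3 (by linarith)
    have e5 : (a * N (hist X k ω) + b) / (k + (1 + θ) / 2) =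
        2 * ((a * N (hist X k ω) + b) / (2 * k + 1 + θ)) := by
      rw [show (k : ℝ) + (1 + θ) / 2 = (2 * k + 1 + θ) / 2 by ring, div_div_eq_mul_div]
      ring
    linarith
  · intro m
    obtain ⟨C₁, hC₁⟩ := hs₁ m
    obtain ⟨C₂, hC₂⟩ := hs₂ m
    refine ⟨C₁ + C₂, fun n => ?_⟩
    have e : ∑ k ∈ Finset.range n,
          {ω | X k ω ∈ P₁ (hist X k ω)}.indicator (fun _ => (1 : ℝ)) ω +
        ∑ k ∈ Finset.range n, {ω | X k ω ∈ P₂ (hist X k ω)}.indicator (fun _ => (1 : ℝ)) ω ≤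
        N (hist X n ω) := by
      induction n with
      | zero => simpa [hist] using hN0
      | succ n ih =>
        rw [Finset.sum_range_succ, Finset.sum_range_succ]
        linarith [hN n]
    rw [Finset.sum_add_distrib, mul_add]
    linarith [hC₁ n, hC₂ n]

/-- With `V` actors the weight of a new one is `θ + α V`, so the exponent is `α`; as `V ≥ 1`, the
weight stays above `α + θ > 0`. -/
theorem ae_rpow_le_card (hα0 : 0 < α) (hα1 : α < 1) (hθ : -α < θ)
    (hX : IsHollywoodProcess μ α θ ν X) (hν : ν 2 = 1) :
    ∀ᵐ ω ∂μ, ∀ β < α, ∀ᶠ n : ℕ in atTop, (n : ℝ) ^ β ≤ (roles X n ω).toFinset.card := by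
  refine ae_rpow_le_of_two_events hα0 hα1 hθ hX hν (a := α) (b := θ) (κ₀ := α + θ)
    (N := fun h => h.flatten.toFinset.card) hα0 hα1.le (by linarith)
    (fun h => {x | ∃ i j, x = [i, j] ∧ i ∉ h.flatten})
    (fun h => {x | ∃ i j, x = [i, j] ∧ j ∉ h.flatten ++ [i]}) (by simp) ?_ ?_ ?_ ?_
  · filter_upwards [ae_next hX hν] with ω hω n
    obtain ⟨i, j, hx, -, -⟩ := hω n
    change ((roles X n ω).toFinset.card : ℝ) + _ + _ ≤ (roles X (n + 1) ω).toFinset.card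
    rw [roles_succ, hx, show roles X n ω ++ [i, j] = roles X n ω ++ [i] ++ [j] by simp,
      toFinset_append_singleton _ j]
    have e1 : ((roles X n ω).toFinset.card : ℝ) +
        {ω | X n ω ∈ {x | ∃ i j, x = [i, j] ∧ i ∉ (hist X n ω).flatten}}.indicator
          (fun _ => (1 : ℝ)) ω ≤ (roles X n ω ++ [i]).toFinset.card := by
      rw [toFinset_append_singleton]
      by_cases hi : i ∈ roles X n ω
      · rw [Set.indicator_of_notMem, add_zero]
        · exact_mod_cast Finset.card_le_card (Finset.subset_insert _ _)
        · rintro ⟨i', j', h1, h2⟩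
          rw [hx] at h1
          simp only [List.cons.injEq, and_true] at h1
          exact h2 (h1.1 ▸ hi)
      · rw [Finset.card_insert_of_notMem (by simpa using hi)]
        push_cast
        gcongr
        exact Set.indicator_le_self' (fun _ _ => zero_le_one) ω
    refine (add_le_add_left e1 _).trans ?_
    by_cases hj : j ∈ roles X n ω ++ [i]
    · rw [Set.indicator_of_notMem, add_zero]
      · exact_mod_cast Finset.card_le_card (Finset.subset_insert _ _)
      · rintro ⟨i', j', h1, h2⟩
        rw [hx] at h1
        simp only [List.cons.injEq, and_true] at h1
        obtain ⟨rfl, rfl⟩ := h1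
        exact h2 hj
    · rw [Finset.card_insert_of_notMem (by rwa [List.mem_toFinset])]
      push_cast
      gcongr
      exact Set.indicator_le_self' (fun _ _ => zero_le_one) ω
  · intro h _ hne
    have := one_le_card hne
    nlinarith
  · intro h hh hne
    rw [add_comm (α * _) θ]
    exact le_pairPr_first_new hα0 hα1 hθ hne hh
  · intro h hh hne
    rw [add_comm (α * _) θ]
    exact le_pairPr_second_new hα0 hα1 hθ hne hh

/-- Actor `1` is chosen with weight `count - α`, of slope one in the count, hence every exponent
below `1`. -/
theorem ae_rpow_le_count_one (hα0 : 0 < α) (hα1 : α < 1) (hθ : -α < θ)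
    (hX : IsHollywoodProcess μ α θ ν X) (hν : ν 2 = 1) :
    ∀ᵐ ω ∂μ, ∀ β < (1 : ℝ), ∀ᶠ n : ℕ in atTop, (n : ℝ) ^ β ≤ (roles X n ω).count 1 := by
  refine ae_rpow_le_of_two_events hα0 hα1 hθ hX hν (a := 1) (b := -α) (κ₀ := 1 - α)
    (N := fun h => h.flatten.count 1) one_pos le_rfl (by linarith)
    (fun h => {x | ∃ i j, x = [i, j] ∧ i ∈ ({1} : Finset ℕ)})
    (fun h => {x | ∃ i j, x = [i, j] ∧ j ∈ ({1} : Finset ℕ)}) (by simp) ?_ ?_ ?_ ?_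
  · filter_upwards [ae_next hX hν] with ω hω n
    obtain ⟨i, j, hx, -, -⟩ := hω n
    change ((roles X n ω).count 1 : ℝ) + _ + _ ≤ (roles X (n + 1) ω).count 1
    rw [roles_succ, hx, List.count_append]
    classical
    simp only [Set.indicator_apply, Set.mem_ofPred_eq, hx, List.cons.injEq, and_true,
      Finset.mem_singleton]
    by_cases hi : i = 1 <;> by_cases hj : j = 1 <;> simp [hi, hj, add_assoc]; norm_num
  · intro h hh hne
    have := one_le_count (hh.one_mem hne)
    linarith
  · intro h hh hne
    have := le_pairPr_first_mem hα1 hθ hh (T := {1}) (by simpa using hh.one_mem hne)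
    simpa [sub_eq_add_neg] using this
  · intro h hh hne
    have := le_pairPr_second_mem hα0 hα1 hθ hh (T := {1}) (by simpa using hh.one_mem hne)
    simpa [sub_eq_add_neg] using this

/-- The actors that occur at least `j` times as the second role of an interaction in which
actor `1` has the first role. -/
def partners (j : ℕ) (h : List (List ℕ)) : Finset ℕ :=
  h.flatten.toFinset.filter fun i => j ≤ h.count [1, i]

omit [MeasurableSpace Ω] in
theorem partners_hist_mono (j : ℕ) (ω : Ω) : Monotone fun n => partners j (hist X n ω) := by
  refine monotone_nat_of_le_succ fun n i => ?_
  simp only [partners, Finset.mem_filter, List.mem_toFinset, hist_succ, List.flatten_append,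
    List.mem_append, List.count_append]
  exact fun h => ⟨Or.inl h.1, h.2.trans (Nat.le_add_right _ _)⟩

/-- Induction on `j`: actors in level `j` but not yet in level `j + 1` are promoted when drawn as
second role after actor `1`. The near-linear degree of actor `1` makes the promotion rate at least
`k ^ (-1 - ε)`, enough for the transfer lemma. -/
theorem ae_rpow_le_card_partners (hα0 : 0 < α) (hα1 : α < 1) (hθ : -α < θ)
    (hX : IsHollywoodProcess μ α θ ν X) (hν : ν 2 = 1) (j : ℕ) :
    ∀ᵐ ω ∂μ, ∀ β < α, ∀ᶠ n : ℕ in atTop, (n : ℝ) ^ β ≤ (partners j (hist X n ω)).card := by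
  induction j with
  | zero => simpa [partners, roles] using ae_rpow_le_card hα0 hα1 hθ hX hν
  | succ j ih =>
    let P : List (List ℕ) → Set (List ℕ) := fun h =>
      {x | ∃ i ∈ partners j h \ partners (j + 1) h, x = [1, i]}
    filter_upwards [ih, ae_rpow_le_count_one hα0 hα1 hθ hX hν, ae_isCast hX hν,
      ae_exists_sum_pairPr_sub_le hα0 hα1 hθ hX hν P (κ := 1 / 2) (by norm_num) (by norm_num)]
      with ω hM hD hc hs β hβ
    refine eventually_rpow_le_of_transfer (α := α) (M := fun n => (partners j (hist X n ω)).card)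
      (r := fun k => (((roles X k ω).count 1 : ℝ) - α) / (2 * k + θ) *
        ((1 - α) / (2 * k + 1 + θ)))
      (q := fun k => pairPr α θ (roles X k ω) (P (hist X k ω))) hα0 hM ?_ ?_ ?_ ?_ ?_ hβ
    · intro m n hmn
      exact Nat.cast_le.2 (Finset.card_le_card (partners_hist_mono (j + 1) ω hmn))
    · intro ε hε
      -- The minimum with `1 / 2` keeps the exponents positive. Half of the loss is reserved to
      -- absorb `α` and the factor `16`, which comes from bounding both denominators by `4 * k`.
      have hr := eventually_rpow_le_mul_rpow_sub (β := 1 - min ε (1 / 2))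
        (β' := 1 - min ε (1 / 2) / 2) (c := (1 - α) / 16)
        (by have : 0 < min ε (1 / 2) := by positivity
            linarith) (by linarith [min_le_right ε (1 / 2)])
        (by linarith) ((1 - α) / 16 * α)
      filter_upwards [hr, hD (1 - min ε (1 / 2) / 2) (by
        have : 0 < min ε (1 / 2) := by positivity
        linarith), eventually_ge_atTop 1,
        tendsto_natCast_atTop_atTop.eventually_ge_atTop (1 + θ)] with k h1 h2 hk hkθ
      have hk' : (1 : ℝ) ≤ k := by exact_mod_cast hk
      have hk0 : (0 : ℝ) < k := by linarith
      have h3 : (k : ℝ) ^ (-1 - ε) ≤ (k : ℝ) ^ (1 - min ε (1 / 2)) * (k : ℝ) ^ (-2 : ℝ) := by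
        rw [← Real.rpow_add hk0]
        exact Real.rpow_le_rpow_of_exponent_le hk' (by linarith [min_le_left ε (1 / 2)])
      have h4 : (k : ℝ) ^ (1 - min ε (1 / 2)) ≤
          (1 - α) / 16 * (((roles X k ω).count 1 : ℝ) - α) := by
        have := mul_le_mul_of_nonneg_left h2 (show 0 ≤ (1 - α) / 16 by linarith)
        linarith
      have h5 : (k : ℝ) ^ (-2 : ℝ) = 1 / (k * k) := by
        rw [Real.rpow_neg hk0.le, one_div, ← sq]
        norm_num
      have h6 : 0 ≤ ((roles X k ω).count 1 : ℝ) - α := by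
        have : 0 < (k : ℝ) ^ (1 - min ε (1 / 2)) := by positivity
        have : 0 < (1 - α) / 16 * (((roles X k ω).count 1 : ℝ) - α) := by linarith
        exact (pos_of_mul_pos_right this (by linarith)).le
      calc (k : ℝ) ^ (-1 - ε)
          ≤ (1 - α) / 16 * (((roles X k ω).count 1 : ℝ) - α) * (1 / (k * k)) := by
            rw [← h5]
            exact h3.trans (mul_le_mul_of_nonneg_right h4 (by positivity))
        _ = (((roles X k ω).count 1 : ℝ) - α) / (4 * k) * ((1 - α) / (4 * k)) := by
            field_simp; ring
        _ ≤ _ := by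
            refine mul_le_mul ?_ ?_ (div_nonneg (by linarith) (by linarith))
              (div_nonneg h6 (by linarith))
            · exact div_le_div_of_nonneg_left h6 (by linarith) (by linarith)
            · exact div_le_div_of_nonneg_left (by linarith) (by linarith) (by linarith)
    · exact fun k => pairPr_nonneg hα0 hα1 hθ _ _
    · intro k hk
      have hne := roles_ne_nil hk (hc k).2
      have := le_pairPr_one hα0 hα1 hθ (hc k).1 ((hc k).1.one_mem hne)
        (T := partners j (hist X k ω) \ partners (j + 1) (hist X k ω))
        (Finset.sdiff_subset.trans (Finset.filter_subset _ _)) (P (hist X k ω))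
        (fun i hi => ⟨i, hi, rfl⟩)
      rw [Finset.cast_card_sdiff, (hc k).2] at this
      · push_cast at this
        refine le_trans (le_of_eq ?_) this
        ring
      · intro i
        simp only [partners, Finset.mem_filter]
        exact fun h => ⟨h.1, by omega⟩
    · obtain ⟨C, hC⟩ := hs
      norm_num only at hC
      refine ⟨C, fun n => (hC n).trans ?_⟩
      induction n with
      | zero => simp
      | succ n ih =>
        rw [Finset.sum_range_succ]
        have hsub := partners_hist_mono (X := X) (j + 1) ω n.le_succ
        by_cases hx : X n ω ∈ P (hist X n ω)
        · rw [Set.indicator_of_mem (by exact hx)]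
          obtain ⟨i, hi, hxi⟩ := hx
          rw [Finset.mem_sdiff] at hi
          have hmem : i ∈ partners (j + 1) (hist X (n + 1) ω) := by
            have h1 := hi.1
            simp only [partners, Finset.mem_filter, List.mem_toFinset, hist_succ,
              List.flatten_append, List.mem_append, List.count_append, hxi] at h1 ⊢
            exact ⟨Or.inl h1.1, by simpa using h1.2⟩
          have := Finset.card_le_card (Finset.insert_subset hmem hsub)
          rw [Finset.card_insert_of_notMem hi.2] at this
          have : ((partners (j + 1) (hist X n ω)).card : ℝ) + 1 ≤
            (partners (j + 1) (hist X (n + 1) ω)).card := by exact_mod_cast this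
          linarith
        · rw [Set.indicator_of_notMem (by exact hx), add_zero]
          refine ih.trans ?_
          exact_mod_cast Finset.card_le_card hsub

end Lower

/-! ### Expected number of roles outside a set of actors -/

section Upper
variable {Ω : Type*} {X : ℕ → Ω → List ℕ} [MeasurableSpace Ω] {μ : Measure Ω}
  [IsProbabilityMeasure μ] {α θ : ℝ} {ν : PMF ℕ}

/-- With `y = n + d` the factor is `(y + 1) / (y + 1 - γ)`, and Bernoulli at `-1 / (y + 1)` bounds
it by `((y + 1) / y) ^ γ`; these powers telescope. -/
theorem le_mul_rpow_of_le_mul {u : ℕ → ℝ} {γ d : ℝ} {s : ℕ} (hγ0 : 0 < γ) (hγ1 : γ ≤ 1)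
    (hs : 0 < s + d) (hu0 : ∀ n, 0 ≤ u n)
    (hu : ∀ n ≥ s, u (n + 1) ≤ (1 + γ / (n + d + 1 - γ)) * u n) {n : ℕ} (hn : s ≤ n) :
    u n ≤ u s * ((n + d) / (s + d)) ^ γ := by
  induction n, hn using Nat.le_induction with
  | base => rw [div_self hs.ne', Real.one_rpow, mul_one]
  | succ n hn ih =>
    have hn' : (s : ℝ) ≤ n := by exact_mod_cast hn
    set y : ℝ := n + d with hy
    have hy0 : 0 < y := by linarith
    have h1 : (y / (y + 1)) ^ γ ≤ (y + 1 - γ) / (y + 1) := by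
      have := rpow_one_add_le_one_add_mul_self (s := -(1 / (y + 1))) (p := γ)
        (by rw [neg_le_neg_iff, div_le_one (by linarith)]; linarith) hγ0.le hγ1
      convert this using 1
      · congr 1; field_simp; ring
      · field_simp; ring
    have hpow : 0 < (y / (y + 1)) ^ γ := by positivity
    have h2 : 1 + γ / (y + 1 - γ) ≤ ((y + 1) / y) ^ γ := by
      rw [← inv_div y, Real.inv_rpow (by positivity)]
      refine le_trans (le_of_eq ?_) (inv_anti₀ hpow h1)
      have : y + 1 - γ ≠ 0 := by linarith
      rw [inv_div]
      field_simp
      ring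
    have hq : 0 ≤ γ / (y + 1 - γ) := div_nonneg hγ0.le (by linarith)
    calc u (n + 1) ≤ (1 + γ / (y + 1 - γ)) * u n := hu n hn
      _ ≤ ((y + 1) / y) ^ γ * (u s * (y / (s + d)) ^ γ) :=
          mul_le_mul h2 ih (hu0 n) (by positivity)
      _ = u s * (((y + 1) / y) ^ γ * (y / (s + d)) ^ γ) := by ring
      _ = u s * ((((n + 1 : ℕ) : ℝ) + d) / (s + d)) ^ γ := by
          rw [← Real.mul_rpow (by positivity) (by positivity)]
          congr 2
          push_cast
          rw [show (n : ℝ) + 1 + d = y + 1 by rw [hy]; ring]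
          field_simp

theorem exists_ratio_le {d : ℝ} (hd : 0 < 1 + d) :
    ∃ K : ℝ, 0 < K ∧ ∀ s n : ℕ, 1 ≤ s → s ≤ n → ((n : ℝ) + d) / (s + d) ≤ K * (n / s) := by
  refine ⟨(1 + |d|) / min 1 (1 + d), by positivity, fun s n hs hn => ?_⟩
  have hs' : (1 : ℝ) ≤ s := by exact_mod_cast hs
  have hn' : (1 : ℝ) ≤ n := by exact_mod_cast hs.trans hn
  rw [div_mul_div_comm]
  have h1 : (n : ℝ) + d ≤ (1 + |d|) * n := by
    have := le_abs_self d
    nlinarith [abs_nonneg d]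
  have h2 : min 1 (1 + d) * s ≤ s + d := by
    rcases le_total 0 d with h | h
    · have := min_le_left 1 (1 + d)
      nlinarith
    · have := min_le_right 1 (1 + d)
      nlinarith
  exact div_le_div₀ (by positivity) h1 (by positivity) h2

/-- An upper bound, up to normalization, for the probability that a role is given to an actor
outside of the set `T` when the roles in `h` have been cast. -/
noncomputable def outsideWeight (α θ : ℝ) (T : Finset ℕ) (h : List ℕ) : ℝ :=
  1 + θ + α * T.card + (h.filter (· ∉ T)).length

theorem outsideWeight_pos (hα0 : 0 < α) (hα1 : α < 1) (hθ : -α < θ) (T : Finset ℕ)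
    (h : List ℕ) : 0 < outsideWeight α θ T h := by
  have h1 : 0 ≤ α * T.card := by positivity
  have h2 : (0 : ℝ) ≤ (h.filter (· ∉ T)).length := Nat.cast_nonneg _
  unfold outsideWeight
  linarith

theorem one_sub_le_pairPr_first (hα1 : α < 1) (hθ : -α < θ) {h : List ℕ}
    (hh : IsCast h) (hne : h ≠ []) {T : Finset ℕ} (hT : T ⊆ h.toFinset) :
    1 - outsideWeight α θ T h / (h.length + θ) ≤
      pairPr α θ h {x | ∃ i j, x = [i, j] ∧ i ∈ T} := by
  refine le_trans ?_ (le_pairPr_first_mem hα1 hθ hh hT)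
  have := length_add_pos hα1 hθ hne
  rw [sum_count_sub, outsideWeight, le_div_iff₀ this, sub_mul, div_mul_cancel₀ _ this.ne']
  linarith

/-- The summand `1` in the weight accounts for the role filled in between, so both roles obey the
same bound, with denominator `h.length + θ`. -/
theorem one_sub_le_pairPr_second (hα0 : 0 < α) (hα1 : α < 1) (hθ : -α < θ) {h : List ℕ}
    (hh : IsCast h) (hne : h ≠ []) {T : Finset ℕ} (hT : T ⊆ h.toFinset) :
    1 - outsideWeight α θ T h / (h.length + θ) ≤
      pairPr α θ h {x | ∃ i j, x = [i, j] ∧ j ∈ T} := by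
  refine le_trans ?_ (le_pairPr_second_mem hα0 hα1 hθ hh hT)
  have hp := length_add_pos hα1 hθ hne
  have hW := outsideWeight_pos hα0 hα1 hθ T h
  have h1 : outsideWeight α θ T h / (h.length + 1 + θ) ≤
      outsideWeight α θ T h / (h.length + θ) :=
    div_le_div_of_nonneg_left hW.le hp (by linarith)
  refine (sub_le_sub_left h1 1).trans ?_
  have hp' : 0 < (h.length : ℝ) + 1 + θ := by linarith
  rw [sum_count_sub, outsideWeight, le_div_iff₀ hp', sub_mul, div_mul_cancel₀ _ hp'.ne']
  linarith

variable (hα0 : 0 < α) (hα1 : α < 1) (hθ : -α < θ) (hX : IsHollywoodProcess μ α θ ν X)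
  (hν : ν 2 = 1)

include hα0 hα1 hθ hX hν in
theorem integrable_outsideWeight {T : List (List ℕ) → Finset ℕ}
    (hT : ∀ h, T h ⊆ h.flatten.toFinset) (n : ℕ) :
    Integrable (fun ω => outsideWeight α θ (T (hist X n ω)) (roles X n ω)) μ := by
  refine Integrable.of_bound (C := 1 + θ + α * (2 * n) + 2 * n)
    ((stronglyMeasurable_comp_hist hX.measurableSet_eq n
      fun h => outsideWeight α θ (T h) h.flatten).mono
      ((histFiltration hX.measurableSet_eq).le n)).aestronglyMeasurable ?_
  filter_upwards [ae_isCast hX hν] with ω hω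
  rw [Real.norm_of_nonneg (outsideWeight_pos hα0 hα1 hθ _ _).le, outsideWeight]
  have h1 : (T (hist X n ω)).card ≤ 2 * n := by
    rw [← (hω n).2]
    exact (Finset.card_le_card (hT _)).trans (List.toFinset_card_le _)
  have h2 : ((roles X n ω).filter (· ∉ T (hist X n ω))).length ≤ 2 * n := by
    rw [← (hω n).2]
    exact List.length_filter_le _ _
  have h1' : ((T (hist X n ω)).card : ℝ) ≤ 2 * n := by exact_mod_cast h1
  have h2' : (((roles X n ω).filter (· ∉ T (hist X n ω))).length : ℝ) ≤ 2 * n := by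
    exact_mod_cast h2
  have := mul_le_mul_of_nonneg_left h1' hα0.le
  linarith

-- Integrating the conditional lower bound for `P` and taking complements turns it into an upper
-- bound.
include hα0 hα1 hθ hX hν in
theorem integral_indicator_compl_le {T : List (List ℕ) → Finset ℕ}
    (hT : ∀ h, T h ⊆ h.flatten.toFinset) {n : ℕ} (hn : 1 ≤ n)
    (P : List (List ℕ) → Set (List ℕ))
    (hP : ∀ h, IsCast h.flatten → h.flatten ≠ [] →
      1 - outsideWeight α θ (T h) h.flatten / (h.flatten.length + θ) ≤
        pairPr α θ h.flatten (P h)) :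
    ∫ ω, {ω | X n ω ∉ P (hist X n ω)}.indicator (fun _ => (1 : ℝ)) ω ∂μ ≤
      (∫ ω, outsideWeight α θ (T (hist X n ω)) (roles X n ω) ∂μ) / (2 * n + θ) := by
  set ℱ := histFiltration hX.measurableSet_eq
  have hms := ℱ.le _ _ (measurableSet_next hX.measurableSet_eq n P)
  have hi : Integrable ({ω | X n ω ∈ P (hist X n ω)}.indicator (fun _ => (1 : ℝ))) μ :=
    (integrable_const 1).indicator hms
  have hcompl : (fun ω => {ω | X n ω ∉ P (hist X n ω)}.indicator (fun _ => (1 : ℝ)) ω) =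
      fun ω => 1 - {ω | X n ω ∈ P (hist X n ω)}.indicator (fun _ => (1 : ℝ)) ω := by
    classical
    ext ω
    simp only [Set.indicator_apply, Set.mem_ofPred_eq]
    split_ifs <;> simp_all
  have hW := integrable_outsideWeight hα0 hα1 hθ hX hν hT n
  have h1 : ∫ ω, (1 - outsideWeight α θ (T (hist X n ω)) (roles X n ω) / (2 * n + θ)) ∂μ ≤
      ∫ ω, {ω | X n ω ∈ P (hist X n ω)}.indicator (fun _ => (1 : ℝ)) ω ∂μ := by
    rw [← integral_condExp (ℱ.le n) (f := {ω | X n ω ∈ P (hist X n ω)}.indicator _)]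
    refine integral_mono_ae ((integrable_const 1).sub (hW.div_const _)) integrable_condExp ?_
    filter_upwards [le_condExp_next hα0 hα1 hθ hX hν n P, ae_isCast hX hν] with ω h1 h2
    refine le_trans ?_ h1
    have := hP (hist X n ω) (h2 n).1 (roles_ne_nil hn (h2 n).2)
    change 1 - outsideWeight α θ _ (roles X n ω) / (((roles X n ω).length : ℝ) + θ) ≤
      pairPr α θ (roles X n ω) _ at this
    rw [(h2 n).2] at this
    push_cast at this
    exact this
  rw [integral_sub (integrable_const 1) (hW.div_const _), integral_const, integral_div] at h1
  rw [hcompl, integral_sub (integrable_const 1) hi, integral_const]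
  linarith

include hα0 hα1 hθ hX hν in
/-- Growth of the expected weight outside of `T`, as long as each role cast outside of `T`
increases the weight by at most `γ`. -/
theorem integral_outsideWeight_succ_le {T : List (List ℕ) → Finset ℕ}
    (hT : ∀ h, T h ⊆ h.flatten.toFinset) {n : ℕ} (hn : 1 ≤ n) {γ : ℝ} (hγ : 0 ≤ γ)
    (hstep : ∀ h i j, h.length = n →
      outsideWeight α θ (T (h ++ [[i, j]])) (h.flatten ++ [i, j]) ≤
        outsideWeight α θ (T h) h.flatten + γ * ((if i ∈ T h then 0 else 1) +
          (if j ∈ T h then 0 else 1))) :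
    ∫ ω, outsideWeight α θ (T (hist X (n + 1) ω)) (roles X (n + 1) ω) ∂μ ≤
      (1 + γ / (n + θ / 2)) *
        ∫ ω, outsideWeight α θ (T (hist X n ω)) (roles X n ω) ∂μ := by
  classical
  let P₁ : List (List ℕ) → Set (List ℕ) := fun h => {x | ∃ i j, x = [i, j] ∧ i ∈ T h}
  let P₂ : List (List ℕ) → Set (List ℕ) := fun h => {x | ∃ i j, x = [i, j] ∧ j ∈ T h}
  have e₁ := integral_indicator_compl_le hα0 hα1 hθ hX hν hT hn P₁
    fun h hh hne => one_sub_le_pairPr_first hα1 hθ hh hne (hT h)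
  have e₂ := integral_indicator_compl_le hα0 hα1 hθ hX hν hT hn P₂
    fun h hh hne => one_sub_le_pairPr_second hα0 hα1 hθ hh hne (hT h)
  have hm : ∀ P : List (List ℕ) → Set (List ℕ), Integrable
      ({ω | X n ω ∉ P (hist X n ω)}.indicator (fun _ => (1 : ℝ))) μ := fun P =>
    (integrable_const 1).indicator ((histFiltration hX.measurableSet_eq).le _ _
      (measurableSet_next hX.measurableSet_eq n P)).compl
  have hW := integrable_outsideWeight hα0 hα1 hθ hX hν hT
  have h1 : ∫ ω, outsideWeight α θ (T (hist X (n + 1) ω)) (roles X (n + 1) ω) ∂μ ≤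
      ∫ ω, (outsideWeight α θ (T (hist X n ω)) (roles X n ω) +
        γ * ({ω | X n ω ∉ P₁ (hist X n ω)}.indicator (fun _ => (1 : ℝ)) ω +
          {ω | X n ω ∉ P₂ (hist X n ω)}.indicator (fun _ => (1 : ℝ)) ω)) ∂μ := by
    refine integral_mono_ae (hW (n + 1))
      ((hW n).add (((hm P₁).add (hm P₂)).const_mul γ)) ?_
    filter_upwards [ae_next hX hν] with ω hω
    obtain ⟨i, j, hx, -, -⟩ := hω n
    have h2 : ∀ P : List (List ℕ) → Set (List ℕ),
        {ω | X n ω ∉ P (hist X n ω)}.indicator (fun _ => (1 : ℝ)) ω =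
          if [i, j] ∈ P (hist X n ω) then 0 else 1 := fun P => by
      simp only [Set.indicator_apply, Set.mem_ofPred_eq, hx]
      split_ifs <;> simp_all
    have h3 : [i, j] ∈ P₁ (hist X n ω) ↔ i ∈ T (hist X n ω) := by
      simp only [P₁, Set.mem_ofPred_eq, List.cons.injEq, and_true]
      exact ⟨fun ⟨i', j', h, hi⟩ => h.1 ▸ hi, fun hi => ⟨i, j, ⟨rfl, rfl⟩, hi⟩⟩
    have h4 : [i, j] ∈ P₂ (hist X n ω) ↔ j ∈ T (hist X n ω) := by
      simp only [P₂, Set.mem_ofPred_eq, List.cons.injEq, and_true]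
      exact ⟨fun ⟨i', j', h, hi⟩ => h.2 ▸ hi, fun hi => ⟨i, j, ⟨rfl, rfl⟩, hi⟩⟩
    rw [roles_succ, hist_succ, hx, h2, h2]
    simp only [h3, h4]
    exact hstep _ i j (length_hist n ω)
  have h12 : Integrable (fun ω => γ *
      ({ω | X n ω ∉ P₁ (hist X n ω)}.indicator (fun _ => (1 : ℝ)) ω +
        {ω | X n ω ∉ P₂ (hist X n ω)}.indicator (fun _ => (1 : ℝ)) ω)) μ :=
    ((hm P₁).add (hm P₂)).const_mul γ
  rw [integral_add (hW n) h12, integral_const_mul,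
    integral_add (hm P₁) (hm P₂)] at h1
  refine h1.trans ?_
  have h5 := mul_le_mul_of_nonneg_left (add_le_add e₁ e₂) hγ
  have h6 : ∀ w : ℝ, γ * (w / (2 * n + θ) + w / (2 * n + θ)) = γ / (n + θ / 2) * w := fun w => by
    have hn' : (1 : ℝ) ≤ n := by exact_mod_cast hn
    have : (n : ℝ) + θ / 2 ≠ 0 := by
      have : 0 < (n : ℝ) + θ / 2 := by linarith
      exact this.ne'
    rw [show 2 * (n : ℝ) + θ = 2 * (n + θ / 2) by ring]
    field_simp
    ring
  rw [h6] at h5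
  linarith

-- With `T` the set of all actors seen, no role lies outside `T`, and a new actor raises the weight
-- by `α`. The growth factor `1 + α / (n + θ / 2)` then yields exponent `α`.
include hα0 hα1 hθ hX hν in
theorem exists_integral_outsideWeight_all_le : ∃ K : ℝ, 0 < K ∧ ∀ n ≥ 1,
    ∫ ω, outsideWeight α θ (roles X n ω).toFinset (roles X n ω) ∂μ ≤ K * (n : ℝ) ^ α := by
  set u : ℕ → ℝ := fun n => ∫ ω, outsideWeight α θ (roles X n ω).toFinset (roles X n ω) ∂μ with hu
  have hu0 : ∀ n, 0 ≤ u n := fun n =>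
    integral_nonneg fun ω => (outsideWeight_pos hα0 hα1 hθ _ _).le
  have hrec : ∀ n ≥ 1, u (n + 1) ≤ (1 + α / (n + (θ / 2 + α - 1) + 1 - α)) * u n := by
    intro n hn
    rw [show (n : ℝ) + (θ / 2 + α - 1) + 1 - α = n + θ / 2 by ring]
    refine integral_outsideWeight_succ_le hα0 hα1 hθ hX hν
      (T := fun h => h.flatten.toFinset) (fun h => subset_rfl) hn hα0.le fun h i j _ => ?_
    have hfil : ∀ l : List ℕ, l.filter (· ∉ l.toFinset) = [] := fun l => by simp
    have hfl : (h ++ [[i, j]]).flatten = h.flatten ++ [i] ++ [j] := by simp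
    rw [show h.flatten ++ [i, j] = (h ++ [[i, j]]).flatten by simp]
    simp only [outsideWeight, hfil]
    rw [hfl, toFinset_append_singleton, toFinset_append_singleton]
    have c1 : ((insert j (insert i h.flatten.toFinset)).card : ℝ) ≤ h.flatten.toFinset.card +
        ((if i ∈ h.flatten.toFinset then 0 else 1) +
          (if j ∈ h.flatten.toFinset then 0 else 1)) := by
      by_cases hi : i ∈ h.flatten.toFinset
      · rw [Finset.insert_eq_of_mem hi, if_pos hi]
        by_cases hj : j ∈ h.flatten.toFinset
        · rw [Finset.insert_eq_of_mem hj, if_pos hj]; simp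
        · rw [Finset.card_insert_of_notMem hj, if_neg hj]; simp
      · rw [if_neg hi]
        by_cases hj : j ∈ h.flatten.toFinset
        · rw [Finset.insert_eq_of_mem (Finset.mem_insert_of_mem hj), if_pos hj,
            Finset.card_insert_of_notMem hi]
          simp
        · rw [if_neg hj]
          have := (Finset.card_insert_le j (insert i h.flatten.toFinset)).trans
            (Nat.succ_le_succ (Finset.card_insert_le i h.flatten.toFinset))
          have : ((insert j (insert i h.flatten.toFinset)).card : ℝ) ≤
            h.flatten.toFinset.card + 1 + 1 := by exact_mod_cast this
          linarith
    have := mul_le_mul_of_nonneg_left c1 hα0.le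
    linarith
  obtain ⟨K, hK, hratio⟩ := exists_ratio_le (d := θ / 2 + α - 1) (by linarith)
  refine ⟨u 1 * K ^ α + 1, by have := hu0 1; positivity, fun n hn => ?_⟩
  have hd : 0 < ((1 : ℕ) : ℝ) + (θ / 2 + α - 1) := by push_cast; linarith
  have hn' : (1 : ℝ) ≤ n := by exact_mod_cast hn
  have h1 := le_mul_rpow_of_le_mul hα0 hα1.le hd hu0 hrec hn
  have h2 : (((n : ℝ) + (θ / 2 + α - 1)) / ((1 : ℕ) + (θ / 2 + α - 1))) ^ α ≤ (K * n) ^ α := by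
    refine Real.rpow_le_rpow (div_nonneg (by push_cast at hd; linarith) hd.le) ?_ hα0.le
    simpa using hratio 1 n le_rfl hn
  rw [Real.mul_rpow hK.le (by linarith)] at h2
  have h3 := mul_le_mul_of_nonneg_left h2 (hu0 1)
  have h4 : 0 ≤ (n : ℝ) ^ α := by positivity
  change u n ≤ _
  linarith

-- Once `T` is frozen at time `s`, each outside role adds one to the weight, so its mean grows at
-- most linearly from order `s ^ α`, giving `s ^ α * (n / s)`.
include hα0 hα1 hθ hX hν in
theorem exists_integral_outsideWeight_take_le : ∃ K : ℝ, 0 < K ∧ ∀ s n : ℕ, 1 ≤ s → s ≤ n →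
    ∫ ω, outsideWeight α θ (roles X s ω).toFinset (roles X n ω) ∂μ ≤
      K * ((s : ℝ) ^ (α - 1) * n) := by
  obtain ⟨K₁, hK₁, h₁⟩ := exists_integral_outsideWeight_all_le hα0 hα1 hθ hX hν
  obtain ⟨K₂, hK₂, hratio⟩ := exists_ratio_le (d := θ / 2) (by linarith)
  refine ⟨K₁ * K₂, by positivity, fun s n hs hn => ?_⟩
  set u : ℕ → ℝ := fun n => ∫ ω, outsideWeight α θ ((hist X n ω).take s).flatten.toFinset
    (roles X n ω) ∂μ with hu
  have hu0 : ∀ n, 0 ≤ u n := fun n =>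
    integral_nonneg fun ω => (outsideWeight_pos hα0 hα1 hθ _ _).le
  have hrec : ∀ n ≥ s, u (n + 1) ≤ (1 + 1 / (n + θ / 2 + 1 - 1)) * u n := by
    intro n hn
    rw [add_sub_cancel_right]
    -- The frozen set is expressed through `take s`, since `T` has to be a function of the current
    -- history.
    refine integral_outsideWeight_succ_le hα0 hα1 hθ hX hν
      (T := fun h => (h.take s).flatten.toFinset) (fun h i => ?_) (hs.trans hn) zero_le_one
      fun h i j hl => ?_
    · simp only [List.mem_toFinset, List.mem_flatten]
      exact fun ⟨l, hl, hi⟩ => ⟨l, List.mem_of_mem_take hl, hi⟩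
    · have ht : (h ++ [[i, j]]).take s = h.take s :=
        List.take_append_of_le_length (by omega)
      rw [ht]
      simp only [outsideWeight, List.filter_append, List.length_append]
      push_cast
      rw [← add_assoc, add_le_add_iff_left, List.filter_cons, List.filter_cons]
      split_ifs <;> simp_all; norm_num
  have hs' : (1 : ℝ) ≤ s := by exact_mod_cast hs
  have h2 := le_mul_rpow_of_le_mul one_pos le_rfl (by linarith) hu0 hrec hn
  rw [Real.rpow_one] at h2
  have h3 : u n = ∫ ω, outsideWeight α θ (roles X s ω).toFinset (roles X n ω) ∂μ := by
    simp only [hu, ← hist_eq_take hn, roles]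
  have h4 : u s = ∫ ω, outsideWeight α θ (roles X s ω).toFinset (roles X s ω) ∂μ := by
    simp only [hu, ← hist_eq_take le_rfl, roles]
  rw [← h3]
  have h5 := h₁ s hs
  rw [← h4] at h5
  have h6 := hratio s n hs hn
  calc u n ≤ _ := h2
    _ ≤ (K₁ * (s : ℝ) ^ α) * (K₂ * (n / s)) := by
        refine mul_le_mul h5 h6 (div_nonneg ?_ (by linarith)) (by positivity)
        have : (s : ℝ) ≤ n := by exact_mod_cast hn
        linarith
    _ = _ := by
        rw [Real.rpow_sub_one (by linarith)]
        ring

end Upper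

/-! ### Almost sure upper bound for the number of distinct interactions -/

section EdgeBound
variable {Ω : Type*} {X : ℕ → Ω → List ℕ} [MeasurableSpace Ω] {μ : Measure Ω}
  [IsProbabilityMeasure μ] {α θ : ℝ} {ν : PMF ℕ}

/-- Markov's inequality gives the summable bound `K * 2 ^ (-ε * j)`, and Borel–Cantelli applies. -/
theorem ae_eventually_le_of_integral_le {W : ℕ → Ω → ℝ} {b : ℕ → ℝ} {K ε : ℝ}
    (hW : ∀ j, Integrable (W j) μ) (hW0 : ∀ j ω, 0 ≤ W j ω) (hb : ∀ j, 0 < b j) (hK : 0 < K)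
    (h : ∀ j, ∫ ω, W j ω ∂μ ≤ K * b j) (hε : 0 < ε) :
    ∀ᵐ ω ∂μ, ∀ᶠ j : ℕ in atTop, W j ω ≤ b j * (2 : ℝ) ^ (j * ε) := by
  have hsum : ∑' j : ℕ, μ {ω | b j * (2 : ℝ) ^ (j * ε) ≤ W j ω} ≠ ∞ := by
    have hr : Summable fun j : ℕ => K * ((2 : ℝ) ^ (-ε)) ^ j :=
      (summable_geometric_of_lt_one (by positivity)
        (Real.rpow_lt_one_of_one_lt_of_neg (by norm_num) (by linarith))).mul_left K
    refine ne_top_of_le_ne_top hr.tsum_ofReal_ne_top (ENNReal.tsum_le_tsum fun j => ?_)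
    rw [← ofReal_measureReal]
    refine ENNReal.ofReal_le_ofReal ?_
    have hp : 0 < b j * (2 : ℝ) ^ (j * ε) := mul_pos (hb j) (by positivity)
    have h1 := (mul_meas_ge_le_integral_of_nonneg (ae_of_all _ (hW0 j)) (hW j)
      (b j * (2 : ℝ) ^ (j * ε))).trans (h j)
    rw [← le_div_iff₀' hp] at h1
    refine h1.trans (le_of_eq ?_)
    rw [← Real.rpow_mul_natCast (by norm_num), mul_div_mul_comm, mul_comm (j : ℝ), neg_mul,
      Real.rpow_neg (by norm_num)]
    have := (hb j).ne'
    field_simp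
  filter_upwards [ae_eventually_notMem hsum] with ω hω
  filter_upwards [hω] with j hj
  exact (not_le.1 hj).le

theorem length_filter_exists_le (S : Finset ℕ) (L : List (List ℕ)) :
    (L.filter fun x => ∃ i ∈ x, i ∉ S).length ≤ (L.flatten.filter (· ∉ S)).length := by
  induction L with
  | nil => simp
  | cons x L ih =>
    rw [List.filter_cons, List.flatten_cons, List.filter_append, List.length_append]
    split_ifs with h
    · have h' : ∃ i ∈ x, i ∉ S := by simpa using h
      obtain ⟨i, hi, hiS⟩ := h'
      have : 0 < (x.filter (· ∉ S)).length :=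
        List.length_pos_of_mem (List.mem_filter.2 ⟨hi, by simpa using hiS⟩)
      simp only [List.length_cons]
      omega
    · omega

/-- A pair with both entries in `S` is one of `S.card ^ 2`; any other uses up at least one role
outside `S`. -/
theorem card_toFinset_le (S : Finset ℕ) {L : List (List ℕ)}
    (hL : ∀ x ∈ L, ∃ i j, x = [i, j]) :
    L.toFinset.card ≤ S.card ^ 2 + (L.flatten.filter (· ∉ S)).length := by
  have hsub : L.toFinset ⊆ (S ×ˢ S).image (fun p => [p.1, p.2]) ∪
      (L.filter fun x => ∃ i ∈ x, i ∉ S).toFinset := by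
    intro x hx
    rw [List.mem_toFinset] at hx
    rw [Finset.mem_union, List.mem_toFinset, List.mem_filter]
    by_cases h : ∃ i ∈ x, i ∉ S
    · exact Or.inr ⟨hx, by simpa using h⟩
    · left
      push Not at h
      obtain ⟨i, j, rfl⟩ := hL x hx
      exact Finset.mem_image.2 ⟨(i, j), Finset.mem_product.2
        ⟨h i (by simp), h j (by simp)⟩, rfl⟩
  refine (Finset.card_le_card hsub).trans ((Finset.card_union_le _ _).trans (add_le_add ?_ ?_))
  · exact Finset.card_image_le.trans (by rw [Finset.card_product, sq])
  · exact (List.toFinset_card_le _).trans (length_filter_exists_le S L)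

omit [MeasurableSpace Ω] in
theorem toFinset_hist_mono (ω : Ω) : Monotone fun n => (hist X n ω).toFinset := by
  intro m n hmn x
  simp only [List.mem_toFinset, mem_hist]
  exact fun ⟨k, hk, h⟩ => ⟨k, hk.trans_le hmn, h⟩

theorem ae_card_toFinset_hist_le (hα0 : 0 < α) (hα1 : α < 1) (hθ : -α < θ)
    (hX : IsHollywoodProcess μ α θ ν X) (hν : ν 2 = 1) {ρ : ℝ} (hρ : 2 * α / (1 + α) < ρ) :
    ∀ᵐ ω ∂μ, ∃ C, ∀ᶠ n : ℕ in atTop, ((hist X n ω).toFinset.card : ℝ) ≤ C * (n : ℝ) ^ ρ := by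
  -- The solution of `2 σ α = 1 - σ (1 - α)`, which equalizes the exponents of the two terms in the
  -- count of pairs.
  set σ : ℝ := 1 / (1 + α) with hσ
  have hσ0 : 0 < σ := by positivity
  have hσ1 : σ ≤ 1 := by rw [hσ, div_le_one (by linarith)]; linarith
  have hσα : σ * α = 1 - σ := by rw [hσ]; field_simp; ring
  have hρσ : 2 * α / (1 + α) = 2 * (σ * α) := by rw [hσ]; field_simp
  set ε : ℝ := (ρ - 2 * α / (1 + α)) / 2 with hε
  have hε0 : 0 < ε := by rw [hε]; linarith
  have hρ' : ρ = 2 * (σ * α) + 2 * ε := by rw [← hρσ, hε]; ring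
  have hρ0 : 0 < ρ := by
    have := mul_pos hσ0 hα0
    linarith
  let t : ℕ → ℕ := fun j => ⌊σ * j⌋₊
  have htle : ∀ j, (t j : ℝ) ≤ σ * j := fun j => Nat.floor_le (by positivity)
  have htge : ∀ j, σ * j - 1 ≤ t j := fun j => (Nat.sub_one_lt_floor _).le
  have htj : ∀ j, t j ≤ j := fun j => by
    have h1 : (j : ℝ) * σ ≤ j := mul_le_of_le_one_right (Nat.cast_nonneg j) hσ1
    have h2 : (t j : ℝ) ≤ j := (htle j).trans (by linarith)
    exact_mod_cast h2
  have httop : Tendsto t atTop atTop :=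
    tendsto_nat_floor_atTop.comp (tendsto_natCast_atTop_atTop.const_mul_atTop hσ0)
  have h2pow : ∀ (m : ℕ) (x : ℝ), (((2 ^ m : ℕ) : ℝ)) ^ x = (2 : ℝ) ^ (m * x) := fun m x => by
    rw [Nat.cast_pow, Nat.cast_ofNat, Real.rpow_mul (by norm_num), Real.rpow_natCast]
  obtain ⟨K₁, hK₁, h₁⟩ := exists_integral_outsideWeight_all_le hα0 hα1 hθ hX hν
  obtain ⟨K₂, hK₂, h₂⟩ := exists_integral_outsideWeight_take_le hα0 hα1 hθ hX hν
  have hV := ae_eventually_le_of_integral_le (μ := μ) (ε := ε) (K := K₁ / α)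
    (W := fun j ω => outsideWeight α θ (roles X (2 ^ j) ω).toFinset (roles X (2 ^ j) ω) / α)
    (b := fun j => ((2 ^ j : ℕ) : ℝ) ^ α)
    (fun j => (integrable_outsideWeight hα0 hα1 hθ hX hν
      (T := fun h => h.flatten.toFinset) (fun h => subset_rfl) (2 ^ j)).div_const α)
    (fun j ω => div_nonneg (outsideWeight_pos hα0 hα1 hθ _ _).le hα0.le)
    (fun j => by positivity) (by positivity)
    (fun j => by
      rw [integral_div, div_mul_eq_mul_div]
      exact div_le_div_of_nonneg_right (h₁ _ Nat.one_le_two_pow) hα0.le) hε0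
  have hQ := ae_eventually_le_of_integral_le (μ := μ) (ε := ε) (K := K₂)
    (W := fun j ω => outsideWeight α θ (roles X (2 ^ t j) ω).toFinset (roles X (2 ^ j) ω))
    (b := fun j => ((2 ^ t j : ℕ) : ℝ) ^ (α - 1) * ((2 ^ j : ℕ) : ℝ))
    (fun j => by
      have := integrable_outsideWeight hα0 hα1 hθ hX hν
        (T := fun h => (h.take (2 ^ t j)).flatten.toFinset) (fun h i => by
          simp only [List.mem_toFinset, List.mem_flatten]
          exact fun ⟨l, hl, hi⟩ => ⟨l, List.mem_of_mem_take hl, hi⟩) (2 ^ j)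
      simp only [← hist_eq_take (Nat.pow_le_pow_right two_pos (htj j))] at this
      exact this)
    (fun j ω => (outsideWeight_pos hα0 hα1 hθ _ _).le)
    (fun j => by positivity) hK₂
    (fun j => h₂ _ _ Nat.one_le_two_pow (Nat.pow_le_pow_right two_pos (htj j))) hε0
  filter_upwards [hV, hQ, ae_next hX hν] with ω hV hQ hx
  have hdy : ∀ᶠ j : ℕ in atTop, ((hist X (2 ^ j) ω).toFinset.card : ℝ) ≤
      3 * (2 : ℝ) ^ (j * ρ) := by
    -- The bound on the number of actors is used at the earlier time `2 ^ t j`, the bound on outside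
    -- roles at time `2 ^ j`.
    filter_upwards [httop.eventually hV, hQ] with j hVj hQj
    rw [h2pow, ← Real.rpow_add two_pos, div_le_iff₀ hα0] at hVj
    have hj0 : (0 : ℝ) ≤ j := Nat.cast_nonneg j
    have hcard := card_toFinset_le (roles X (2 ^ t j) ω).toFinset (L := hist X (2 ^ j) ω)
      fun x hxm => by
        obtain ⟨k, -, rfl⟩ := mem_hist.1 hxm
        obtain ⟨i, l, h, -, -⟩ := hx k
        exact ⟨i, l, h⟩
    have hcard' : ((hist X (2 ^ j) ω).toFinset.card : ℝ) ≤
        ((roles X (2 ^ t j) ω).toFinset.card : ℝ) ^ 2 +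
          ((roles X (2 ^ j) ω).filter (· ∉ (roles X (2 ^ t j) ω).toFinset)).length := by
      exact_mod_cast hcard
    have hVle : ((roles X (2 ^ t j) ω).toFinset.card : ℝ) ≤
        (2 : ℝ) ^ ((t j : ℝ) * α + t j * ε) := by
      have h3 : α * ((roles X (2 ^ t j) ω).toFinset.card : ℝ) ≤
          outsideWeight α θ (roles X (2 ^ t j) ω).toFinset (roles X (2 ^ t j) ω) := by
        unfold outsideWeight
        have : (0 : ℝ) ≤ ((roles X (2 ^ t j) ω).filter
          (· ∉ (roles X (2 ^ t j) ω).toFinset)).length := Nat.cast_nonneg _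
        linarith
      have h4 := h3.trans hVj
      rw [mul_comm] at h4
      exact le_of_mul_le_mul_right h4 hα0
    have hV2 : ((roles X (2 ^ t j) ω).toFinset.card : ℝ) ^ 2 ≤ (2 : ℝ) ^ (j * ρ) := by
      refine (pow_le_pow_left₀ (Nat.cast_nonneg _) hVle 2).trans ?_
      rw [← Real.rpow_mul_natCast (by norm_num)]
      refine Real.rpow_le_rpow_of_exponent_le (by norm_num) ?_
      have h5 := mul_le_mul_of_nonneg_right (htle j) hα0.le
      have h6 := mul_le_mul_of_nonneg_right (htle j) hε0.le
      have h7 : σ * j * ε ≤ j * ε := by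
        have := mul_le_mul_of_nonneg_right hσ1 (mul_nonneg hj0 hε0.le)
        linarith
      rw [hρ']
      push_cast
      linarith
    have hQ2 : (((roles X (2 ^ j) ω).filter
        (· ∉ (roles X (2 ^ t j) ω).toFinset)).length : ℝ) ≤ 2 * (2 : ℝ) ^ (j * ρ) := by
      have h3 : (((roles X (2 ^ j) ω).filter
          (· ∉ (roles X (2 ^ t j) ω).toFinset)).length : ℝ) ≤
          outsideWeight α θ (roles X (2 ^ t j) ω).toFinset (roles X (2 ^ j) ω) := by
        unfold outsideWeight
        have : 0 ≤ α * ((roles X (2 ^ t j) ω).toFinset.card : ℝ) :=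
          mul_nonneg hα0.le (Nat.cast_nonneg _)
        linarith
      refine h3.trans (hQj.trans ?_)
      have h4 : ((2 ^ j : ℕ) : ℝ) = (2 : ℝ) ^ (j : ℝ) := by
        rw [Real.rpow_natCast, Nat.cast_pow, Nat.cast_ofNat]
      -- The factor `2` pays for the floor in `t j`, which costs at most `2 ^ (1 - α)`.
      have h5 : (2 : ℝ) * (2 : ℝ) ^ (j * ρ) = (2 : ℝ) ^ (1 + j * ρ) := by
        rw [Real.rpow_add two_pos, Real.rpow_one]
      rw [h2pow, h4, ← Real.rpow_add two_pos, ← Real.rpow_add two_pos, h5]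
      refine Real.rpow_le_rpow_of_exponent_le (by norm_num) ?_
      have h6 := mul_le_mul_of_nonneg_right (htge j) (show 0 ≤ 1 - α by linarith)
      have h7 : (σ * j - 1) * (1 - α) = (2 * σ - 1) * j - (1 - α) := by
        have : σ * j * α = (1 - σ) * j := by rw [← hσα]; ring
        linarith
      have h8 := mul_nonneg hj0 hε0.le
      rw [hρ', hσα]
      linarith
    linarith
  obtain ⟨J, hJ⟩ := eventually_atTop.1 hdy
  refine ⟨3 * (2 : ℝ) ^ ρ, ?_⟩
  filter_upwards [eventually_ge_atTop (2 ^ J)] with n hn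
  have hn0 : n ≠ 0 := (lt_of_lt_of_le (by positivity) hn).ne'
  -- Distinct interactions only accumulate, so `n` is compared with the next power of two, at most
  -- `2 * n`.
  have hlt : n < 2 ^ (Nat.log 2 n + 1) := Nat.lt_pow_succ_log_self one_lt_two n
  have hle : 2 ^ (Nat.log 2 n + 1) ≤ 2 * n := by
    rw [pow_succ']
    exact Nat.mul_le_mul_left 2 (Nat.pow_log_le_self 2 hn0)
  have hJn : J ≤ Nat.log 2 n + 1 :=
    (Nat.le_log_of_pow_le one_lt_two hn).trans (Nat.le_succ _)
  have h1 : ((hist X n ω).toFinset.card : ℝ) ≤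
      (hist X (2 ^ (Nat.log 2 n + 1)) ω).toFinset.card :=
    Nat.cast_le.2 (Finset.card_le_card (toFinset_hist_mono ω hlt.le))
  refine h1.trans ((hJ _ hJn).trans ?_)
  rw [← h2pow, mul_assoc, ← Real.mul_rpow (by norm_num) (Nat.cast_nonneg n)]
  refine mul_le_mul_of_nonneg_left (Real.rpow_le_rpow (Nat.cast_nonneg _) ?_ hρ0.le) (by norm_num)
  exact_mod_cast hle

end EdgeBound

/-! ### From power bounds to sparsity of the projections -/

theorem meanArity_eq_two {H : Set (List ℕ)} (hH : ∀ A ∈ H, A.length = 2)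
    (he : 0 < edgeCount H) : meanArity H = 2 := by
  have h2 : arityCount H 2 = edgeCount H := by
    unfold arityCount edgeCount
    congr 1
    ext A
    exact ⟨fun h => h.1, fun h => ⟨h, hH A h⟩⟩
  have h0 : ∀ k, k ≠ 2 → arityCount H k = 0 := by
    intro k hk
    have : {A ∈ H | A.length = k} = ∅ := by
      ext A
      simp only [Set.mem_ofPred_eq, Set.mem_empty_iff_false, iff_false, not_and]
      rintro hA rfl
      exact hk (hH A hA)
    rw [arityCount, this, Set.ncard_empty]
  rw [meanArity, finsum_eq_single _ 2 fun k hk => by simp [h0 k hk], h2]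
  have : (edgeCount H : ℝ) ≠ 0 := by exact_mod_cast he.ne'
  push_cast
  field_simp

/-- Once there is an edge the exponent is `2`, and the ratio is at most `C * n ^ (ρ - 2 * β)`;
divergence of `M` forces that of the edge count. -/
theorem isSparse_of_rpow_bounds {H : ℕ → Set (List ℕ)} {M : ℕ → ℕ} {C β ρ : ℝ}
    (hH : ∀ n, ∀ A ∈ H n, A.length = 2) (he : ∀ n, M n ≤ edgeCount (H n))
    (hv : ∀ n, M n ≤ vertexCount (H n)) (hβ : 0 < β) (hρ : ρ < 2 * β)
    (hM : ∀ᶠ n : ℕ in atTop, (n : ℝ) ^ β ≤ M n)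
    (hE : ∀ᶠ n : ℕ in atTop, (edgeCount (H n) : ℝ) ≤ C * (n : ℝ) ^ ρ) : IsSparse H := by
  have hMtop : Tendsto M atTop atTop := by
    rw [← tendsto_natCast_atTop_iff (R := ℝ)]
    exact tendsto_atTop_mono' _ hM ((tendsto_rpow_atTop hβ).comp tendsto_natCast_atTop_atTop)
  refine ⟨tendsto_atTop_mono he hMtop, Tendsto.limsup_eq ?_⟩
  have hlim : Tendsto (fun n : ℕ => ENNReal.ofReal (C * (n : ℝ) ^ (-(2 * β - ρ)))) atTop
      (nhds 0) := by
    have h1 : Tendsto (fun n : ℕ => C * (n : ℝ) ^ (-(2 * β - ρ))) atTop (nhds (C * 0)) :=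
      ((tendsto_rpow_neg_atTop (by linarith)).comp tendsto_natCast_atTop_atTop).const_mul C
    rw [mul_zero] at h1
    simpa using ENNReal.tendsto_ofReal h1
  refine tendsto_of_tendsto_of_tendsto_of_le_of_le' tendsto_const_nhds hlim
    (Eventually.of_forall fun n => zero_le) ?_
  filter_upwards [hM, hE, hMtop.eventually_gt_atTop 0, eventually_gt_atTop 0] with n h1 h2 h3 hn
  have hn' : (0 : ℝ) < n := by exact_mod_cast hn
  have hvM : (M n : ℝ) ≤ vertexCount (H n) := by exact_mod_cast hv n
  have hv0 : (0 : ℝ) < vertexCount (H n) := by exact_mod_cast h3.trans_le (hv n)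
  rw [meanArity_eq_two (hH n) (h3.trans_le (he n)), ENNReal.rpow_two,
    ← ENNReal.ofReal_natCast, ← ENNReal.ofReal_natCast, ← ENNReal.ofReal_pow hv0.le,
    ← ENNReal.ofReal_div_of_pos (by positivity)]
  refine ENNReal.ofReal_le_ofReal ?_
  have h4 : ((n : ℝ) ^ β) ^ 2 ≤ (vertexCount (H n) : ℝ) ^ 2 :=
    pow_le_pow_left₀ (by positivity) (h1.trans hvM) 2
  calc (edgeCount (H n) : ℝ) / (vertexCount (H n) : ℝ) ^ 2
      ≤ (C * (n : ℝ) ^ ρ) / ((n : ℝ) ^ β) ^ 2 :=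
        div_le_div₀ ((Nat.cast_nonneg _).trans h2) h2 (by positivity) h4
    _ = C * (n : ℝ) ^ (-(2 * β - ρ)) := by
        rw [← Real.rpow_mul_natCast hn'.le, mul_div_assoc, ← Real.rpow_sub hn']
        congr 2
        push_cast
        ring

theorem count_hist_eq_ncard {Ω : Type*} (X : ℕ → Ω → List ℕ) (n : ℕ) (ω : Ω) (A : List ℕ) :
    (hist X n ω).count A = {i : Fin n | X i ω = A}.ncard := by
  rw [Set.ncard_eq_toFinset_card', Set.toFinset_ofPred]
  induction n with
  | zero => simp [hist]
  | succ n ih =>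
    rw [hist_succ, List.count_append, ih, Finset.card_filter, Finset.card_filter,
      Fin.sum_univ_castSucc]
    simp [List.count_singleton]

/-- Pathwise sparsity of the projections obtained after transforming the interactions by `f`. -/
theorem ae_isSparse_projection {Ω : Type*} {X : ℕ → Ω → List ℕ} [MeasurableSpace Ω]
    {μ : Measure Ω} [IsProbabilityMeasure μ] {α θ : ℝ} {ν : PMF ℕ} (hα0 : 0 < α) (hα1 : α < 1)
    (hθ : -α < θ) (hX : IsHollywoodProcess μ α θ ν X) (hν : ν 2 = 1) {c : ℝ} (hc : 0 ≤ c)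
    (f : List ℕ → List ℕ) (hflen : ∀ x, (f x).length = x.length)
    (hf : ∀ i, 1 ≤ i → f [1, i] = [1, i]) :
    ∀ᵐ ω ∂μ, IsSparse fun n =>
      projection (fun A : Set (Fin n) => (A.ncard : ℝ)) c (fun i => f (X i ω)) := by
  have hα2 : 2 * α / (1 + α) < 2 * α := by
    rw [div_lt_iff₀ (by linarith)]
    nlinarith
  obtain ⟨ρ, hρ1, hρ2⟩ := exists_between hα2
  have hρ0 : 0 < ρ := lt_trans (by positivity) hρ1
  obtain ⟨β, hβ1, hβ2⟩ := exists_between (show ρ / 2 < α by linarith)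
  filter_upwards [ae_rpow_le_card_partners hα0 hα1 hθ hX hν (⌊c⌋₊ + 1),
    ae_card_toFinset_hist_le hα0 hα1 hθ hX hν hρ1, ae_next hX hν, ae_isCast hX hν]
    with ω hM ⟨C, hC⟩ hx hcast
  set H : ℕ → Set (List ℕ) := fun n =>
    projection (fun A : Set (Fin n) => (A.ncard : ℝ)) c (fun i => f (X i ω)) with hHdef
  have hsub : ∀ n, H n ⊆ ((hist X n ω).toFinset.image f : Finset (List ℕ)) := by
    intro n A hA
    have h0 : (0 : ℝ) < ({i : Fin n | f (X i ω) = A}.ncard : ℝ) := hc.trans_lt hA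
    have h1 : {i : Fin n | f (X i ω) = A}.Nonempty :=
      Set.nonempty_of_ncard_ne_zero (by exact_mod_cast h0.ne')
    obtain ⟨i, hi⟩ := h1
    rw [Finset.mem_coe, Finset.mem_image]
    exact ⟨X i ω, List.mem_toFinset.2 (mem_hist.2 ⟨i, i.2, rfl⟩), hi⟩
  -- Needed for the lower bounds, as `ncard` is zero on infinite sets.
  have hfin : ∀ n, (H n).Finite := fun n => (Finset.finite_toSet _).subset (hsub n)
  have hpart : ∀ n, ∀ i ∈ partners (⌊c⌋₊ + 1) (hist X n ω), [1, i] ∈ H n := by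
    intro n i hi
    rw [partners, Finset.mem_filter, count_hist_eq_ncard] at hi
    -- Labels start at `1`, so `f` fixes `[1, i]` and can only raise its multiplicity.
    have hi1 : 1 ≤ i := by
      have h1 : i ∈ (roles X n ω).toFinset := hi.1
      rw [(hcast n).1, Finset.mem_Icc] at h1
      exact h1.1
    have h2 : {k : Fin n | X k ω = [1, i]}.ncard ≤ {k : Fin n | f (X k ω) = [1, i]}.ncard :=
      Set.ncard_le_ncard (fun k (hk : X k ω = [1, i]) => by
        rw [Set.mem_ofPred_eq, hk, hf i hi1]) (Set.toFinite _)
    have h3 : ((⌊c⌋₊ + 1 : ℕ) : ℝ) ≤ ({k : Fin n | f (X k ω) = [1, i]}.ncard : ℝ) := by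
      exact_mod_cast hi.2.trans h2
    have h4 := Nat.lt_floor_add_one c
    push_cast at h3
    exact h4.trans_le h3
  refine isSparse_of_rpow_bounds (M := fun n => (partners (⌊c⌋₊ + 1) (hist X n ω)).card)
    (C := C) (β := β) (ρ := ρ) ?_ ?_ ?_ (by linarith) (by linarith) (hM β hβ2) ?_
  · intro n A hA
    have h1 := hsub n hA
    rw [Finset.mem_coe, Finset.mem_image] at h1
    obtain ⟨x, hx', rfl⟩ := h1
    obtain ⟨k, -, rfl⟩ := mem_hist.1 (List.mem_toFinset.1 hx')
    obtain ⟨i, j, h, -, -⟩ := hx k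
    rw [hflen, h]
    rfl
  · intro n
    have h1 : ((partners (⌊c⌋₊ + 1) (hist X n ω)).image fun i => [1, i]).card =
        (partners (⌊c⌋₊ + 1) (hist X n ω)).card :=
      Finset.card_image_of_injective _ fun i j h => by simpa using h
    rw [← h1, ← Set.ncard_coe_finset]
    refine Set.ncard_le_ncard (fun A hA => ?_) (hfin n)
    rw [Finset.mem_coe, Finset.mem_image] at hA
    obtain ⟨i, hi, rfl⟩ := hA
    exact hpart n i hi
  · intro n
    rw [← Set.ncard_coe_finset]
    refine Set.ncard_le_ncard (fun i hi => ⟨[1, i], hpart n i hi, by simp⟩) ?_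
    have : {u : ℕ | ∃ A ∈ H n, u ∈ A} = ⋃ A ∈ H n, {u | u ∈ A} := by ext; simp
    rw [this]
    exact (hfin n).biUnion fun A _ => List.finite_toSet A
  · filter_upwards [hC] with n hn
    refine le_trans ?_ hn
    have h1 : edgeCount (H n) ≤ ((hist X n ω).toFinset.image f).card := by
      rw [← Set.ncard_coe_finset]
      exact Set.ncard_le_ncard (hsub n) (Finset.finite_toSet _)
    exact_mod_cast h1.trans Finset.card_image_le

end Hollywood

theorem theorem5p4 {Ω : Type*} [MeasurableSpace Ω] (μ : MeasureTheory.Measure Ω)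
    [MeasureTheory.IsProbabilityMeasure μ] (α θ : ℝ) (hα0 : 0 < α) (hα1 : α < 1) (hθ : -α < θ)
    (X : ℕ → Ω → List ℕ) (hX : Hollywood.IsBinaryHollywoodProcess μ α θ X)
    (c : ℝ) (hc : 0 ≤ c) :
    (∀ᵐ ω ∂μ, Hollywood.IsSparse fun n =>
      Hollywood.projection (fun A : Set (Fin n) => (A.ncard : ℝ)) c (fun i => X i ω)) ∧
    (∀ᵐ ω ∂μ, Hollywood.IsSparse fun n =>
      Hollywood.projection (fun A : Set (Fin n) => (A.ncard : ℝ)) c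
        (fun i => Hollywood.unorient (X i ω))) := by
  obtain ⟨ν, hν, hX⟩ := hX
  refine ⟨Hollywood.ae_isSparse_projection hα0 hα1 hθ hX hν hc id (fun _ => rfl) fun _ _ => rfl,
    Hollywood.ae_isSparse_projection hα0 hα1 hθ hX hν hc Hollywood.unorient
      (fun x => List.length_insertionSort _ x) fun i hi => ?_⟩
  -- The list `[1, i]` is already sorted because `1 ≤ i`.
  simp [Hollywood.unorient, hi]
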